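/- **Setting.** Let $n\ge 2$, $T>0$, $s\in(1/2,1)$, $0<\sigma<s$, $0<\lambda\le\Lambda$, $b\in\mathbb{R}^n$, $r\in\mathbb{R}$. Let $\psi:\mathbb{R}^n\to[0,\infty)$ be of class $C^2(\mathbb{R}^n)\cap W^{2,\infty}(\mathbb{R}^n)$. Write $\delta f(x,y)=f(x+y)+f(x-y)-2f(x)$ and $$(-\Delta)^s f(x)=-c_{n,s}\,\mathrm{p.v.}\!\int_{\mathbb{R}^n}\frac{f(y)-f(x)}{|y-x|^{n+2s}}\,dy=-\frac{c_{n,s}}{2}\int_{\mathbb{R}^n}\frac{\delta f(x,y)}{|y|^{n+2s}}\,dy,\qquad c_{n,s}=\frac{4^s\,s\,\Gamma(n/2+s)}{\pi^{n/2}\,\Gamma(1-s)}.$$ Say that $f:\mathbb{R}^n\to\mathbb{R}$ is *evaluable at* $x$ if $\int_{\mathbb{R}^n}\frac{|f(y)|}{1+|y|^{n+2\sigma}}\,dy<\infty$ and, for some $\beta>2\sigma$, $f$ is punctually $C^{\beta}$ at $x$, i.e. for some $M>0$ and all small $y$: $|f(x+y)-f(x)|\le M|y|^{\beta}$ if $\beta\le1$;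 $|f(x+y)-f(x)-p\cdot y|\le M|y|^{\beta}$ for some $p\in\mathbb{R}^n$ if $\beta>1$. Let $\mathcal{I}$ be a (possibly nonlinear) operator with $\mathcal{I}(0)=0$ that is translation-invariant ($\mathcal{I}[f(\cdot+h)](x)=\mathcal{I}f(x+h)$ whenever $f$ is evaluable at $x+h$) and uniformly elliptic: for all $f,g$ evaluable at $x$, $$M^-(f-g)(x)\le \mathcal{I}f(x)-\mathcal{I}g(x)\le M^+(f-g)(x),$$ where $$M^+h(x)=\int_{\mathbb{R}^n}\frac{\Lambda(\delta h(x,y))^+-\lambda(\delta h(x,y))^-}{|y|^{n+2\sigma}}\,dy,\qquad M^-h(x)=\int_{\mathbb{R}^n}\frac{\lambda(\delta h(x,y))^+-\Lambda(\delta h(x,y))^-}{|y|^{n+2\sigma}}\,dy .$$ (Convexity of $\mathcal{I}$ is not required.) Put $\mathcal{L}w=\partial_t w+(-\Delta)^s w-b\cdot\nabla w-\mathcal{I}w-rw$, where the spatial operators act in $x$, and consider the obstacle problem $$\min\{\mathcal{L}u,\;u-\psi\}=0\ \text{ in }(0,T]\times\mathbb{R}^n,\qquad u(0,\cdot)=\psi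 .$$ **Viscosity inequalities.** Let $(t_0,x_0)\in(0,T]\times\mathbb{R}^n$. We say $\mathcal{L}u\le0$ at $(t_0,x_0)$ in the viscosity sense if for every $R>0$ and every $\phi\in C^{1,2}_{t,x}(\overline{B_R(t_0,x_0)})$ with $u(t_0,x_0)=\phi(t_0,x_0)$ and $u<\phi$ at all other points of $B_R(t_0,x_0)\cap((0,T]\times\mathbb{R}^n)$, the function $w$ equal to $\phi$ in $B_R(t_0,x_0)$ and to $u$ outside satisfies $\mathcal{L}w(t_0,x_0)\le0$. Define $\mathcal{L}u\ge0$ in the viscosity sense by reversing both inequalities. A *bounded viscosity subsolution* of the obstacle problem is a function $u$ on $[0,T]\times\mathbb{R}^n$, bounded on $(0,T]\times\mathbb{R}^n$ and upper semicontinuous on $[0,T]\times\mathbb{R}^n$, with $u(0,\cdot)\le\psi$ and $\mathcal{L}u\le0$ in the viscosity sense at every $(t,x)\in(0,T]\times\mathbb{R}^n$ with $u(t,x)>\psi(x)$. A *bounded viscosity supersolution* is a function $v$ on $[0,T]\times\mathbb{R}^n$, bounded on $(0,T]\times\mathbb{R}^n$ and lower semicontinuous on $[0,T]\times\mathbb{R}^n$,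 with $v(0,\cdot)\ge\psi$, $v(t,\cdot)\ge\psi$ for all $t\in(0,T]$, and $\mathcal{L}v\ge0$ in the viscosity sense at every $(t,x)\in(0,T]\times\mathbb{R}^n$. **Theorem (Comparison Principle).** If $u$ is a bounded viscosity subsolution and $v$ is a bounded viscosity supersolution of the obstacle problem, then $u\le v$ on $(0,T]\times\mathbb{R}^n$. -/

import Mathlib

open MeasureTheory Set

noncomputable section

/-- The second-order increment `δf(x,y) = f(x+y) + f(x-y) - 2 f(x)`. -/
def secondDiff {n : ℕ} (f : EuclideanSpace ℝ (Fin n) → ℝ) (x y : EuclideanSpace ℝ (Fin n)) : ℝ :=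
  f (x + y) + f (x - y) - 2 * f x

/-- The normalizing constant `c_{n,s} = 4^s s Γ(n/2 + s) / (π^{n/2} Γ(1 - s))` of the fractional
Laplacian, which gives `(-Δ)^s` the Fourier symbol `|ξ|^{2s}`. -/
def fracLapConst (n : ℕ) (s : ℝ) : ℝ :=
  (4 : ℝ) ^ s * s * Real.Gamma ((n : ℝ) / 2 + s) /
    (Real.pi ^ ((n : ℝ) / 2) * Real.Gamma (1 - s))

/-- The fractional Laplacian
`(-Δ)^s f(x) = - c_{n,s} p.v. ∫ (f(z) - f(x)) / |z - x|^{n+2s} dz`, the principal value being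
written as the symmetrized integral `- (c_{n,s} / 2) ∫ δf(x,y) / |y|^{n+2s} dy`, which converges
absolutely for bounded measurable `f` that are `C²` near `x`. -/
def fracLap {n : ℕ} (s : ℝ) (f : EuclideanSpace ℝ (Fin n) → ℝ) (x : EuclideanSpace ℝ (Fin n)) : ℝ :=
  -(fracLapConst n s / 2) * ∫ y, secondDiff f x y / ‖y‖ ^ ((n : ℝ) + 2 * s)

/-- The maximal extremal operator
`M⁺f(x) = ∫ (Λ (δf(x,y))⁺ - lam (δf(x,y))⁻) / |y|^{n+2σ} dy`. -/
def extremalMax {n : ℕ} (σ lam Lam : ℝ) (f : EuclideanSpace ℝ (Fin n) → ℝ)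
    (x : EuclideanSpace ℝ (Fin n)) : ℝ :=
  ∫ y, (Lam * max (secondDiff f x y) 0 - lam * max (-secondDiff f x y) 0) /
    ‖y‖ ^ ((n : ℝ) + 2 * σ)

/-- The minimal extremal operator
`M⁻f(x) = ∫ (lam (δf(x,y))⁺ - Λ (δf(x,y))⁻) / |y|^{n+2σ} dy`. -/
def extremalMin {n : ℕ} (σ lam Lam : ℝ) (f : EuclideanSpace ℝ (Fin n) → ℝ)
    (x : EuclideanSpace ℝ (Fin n)) : ℝ :=
  ∫ y, (lam * max (secondDiff f x y) 0 - Lam * max (-secondDiff f x y) 0) /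
    ‖y‖ ^ ((n : ℝ) + 2 * σ)

/-- `f` is punctually `C^β` at `x`, for `0 < β`: a bound `M |y|^β` for small `y` on the increment
`f(x+y) - f(x)` if `β ≤ 1`, and on `f(x+y) - f(x) - p·y` for some vector `p` if `β > 1`. -/
def PunctuallyHolder {n : ℕ} (β : ℝ) (f : EuclideanSpace ℝ (Fin n) → ℝ)
    (x : EuclideanSpace ℝ (Fin n)) : Prop :=
  (β ≤ 1 ∧ ∃ M > 0, ∃ ρ > 0, ∀ y : EuclideanSpace ℝ (Fin n), ‖y‖ < ρ →
      |f (x + y) - f x| ≤ M * ‖y‖ ^ β) ∨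
  (1 < β ∧ ∃ p : EuclideanSpace ℝ (Fin n), ∃ M > 0, ∃ ρ > 0,
    ∀ y : EuclideanSpace ℝ (Fin n), ‖y‖ < ρ →
      |f (x + y) - f x - inner ℝ p y| ≤ M * ‖y‖ ^ β)

/-- The functions at which an operator of order `2σ` can be evaluated at the point `x`: punctually
`C^{2σ+α}` at `x` for some `α > 0`, and integrable against the weight `1 / (1 + |y|^{n+2σ})`. -/
def EvaluableAt {n : ℕ} (σ : ℝ) (f : EuclideanSpace ℝ (Fin n) → ℝ)
    (x : EuclideanSpace ℝ (Fin n)) : Prop :=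
  (∃ α > 0, PunctuallyHolder (2 * σ + α) f x) ∧
  Integrable (fun y => f y / (1 + ‖y‖ ^ ((n : ℝ) + 2 * σ)))

/-- `I` is a translation-invariant operator with `I(0) = 0`, uniformly elliptic with respect to the
class of linear operators `Lf(x) = ∫ δf(x,y) K(y) dy` with symmetric kernels satisfying
`lam / |y|^{n+2σ} ≤ K(y) ≤ Λ / |y|^{n+2σ}`. The value `I f x` is only constrained for functions `f`
that can be evaluated at `x`. -/
structure IsEllipticOperator {n : ℕ} (σ lam Lam : ℝ)
    (I : (EuclideanSpace ℝ (Fin n) → ℝ) → EuclideanSpace ℝ (Fin n) → ℝ) : Prop where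
  map_zero : ∀ x, I (fun _ => 0) x = 0
  translation : ∀ (f : EuclideanSpace ℝ (Fin n) → ℝ) (h x : EuclideanSpace ℝ (Fin n)),
    EvaluableAt σ f (x + h) → I (fun y => f (y + h)) x = I f (x + h)
  elliptic : ∀ (f g : EuclideanSpace ℝ (Fin n) → ℝ) (x : EuclideanSpace ℝ (Fin n)),
    EvaluableAt σ f x → EvaluableAt σ g x →
      extremalMin σ lam Lam (fun y => f y - g y) x ≤ I f x - I g x ∧
      I f x - I g x ≤ extremalMax σ lam Lam (fun y => f y - g y) x

/-- The operator `𝓛w = ∂ₜw + (-Δ)^s w - b·∇w - I w - r w` at the point `(t, x)`; the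
nonlocal operators and the gradient act on the variable `x`. -/
def parabolicOp {n : ℕ} (s : ℝ) (b : EuclideanSpace ℝ (Fin n)) (r : ℝ)
    (I : (EuclideanSpace ℝ (Fin n) → ℝ) → EuclideanSpace ℝ (Fin n) → ℝ)
    (w : ℝ → EuclideanSpace ℝ (Fin n) → ℝ) (t : ℝ) (x : EuclideanSpace ℝ (Fin n)) : ℝ :=
  deriv (fun τ => w τ x) t + fracLap s (w t) x - fderiv ℝ (w t) x b - I (w t) x - r * w t x

/-- `φ` is of class `C^{1,2}_{t,x}` on the open set `U` of space-time: `φ`, `∂ₜφ`, `D_xφ`, `D_x²φ`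
exist and are continuous on `U`. -/
def IsC12On {n : ℕ} (φ : ℝ → EuclideanSpace ℝ (Fin n) → ℝ)
    (U : Set (ℝ × EuclideanSpace ℝ (Fin n))) : Prop :=
  ContinuousOn (fun p : ℝ × EuclideanSpace ℝ (Fin n) => φ p.1 p.2) U ∧
  (∀ p ∈ U, DifferentiableAt ℝ (fun τ => φ τ p.2) p.1) ∧
  ContinuousOn (fun p : ℝ × EuclideanSpace ℝ (Fin n) => deriv (fun τ => φ τ p.2) p.1) U ∧
  (∀ p ∈ U, ContDiffAt ℝ 2 (φ p.1) p.2) ∧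
  ContinuousOn (fun p : ℝ × EuclideanSpace ℝ (Fin n) => fderiv ℝ (φ p.1) p.2) U ∧
  ContinuousOn (fun p : ℝ × EuclideanSpace ℝ (Fin n) => fderiv ℝ (fderiv ℝ (φ p.1)) p.2) U

/-- The open Euclidean ball `B_R(t₀,x₀)` of space-time `ℝ × ℝⁿ`. -/
def stBall {n : ℕ} (R t₀ : ℝ) (x₀ : EuclideanSpace ℝ (Fin n)) :
    Set (ℝ × EuclideanSpace ℝ (Fin n)) :=
  {p | (p.1 - t₀) ^ 2 + ‖p.2 - x₀‖ ^ 2 < R ^ 2}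

/-- The closed Euclidean ball of space-time `ℝ × ℝⁿ`. -/
def stClosedBall {n : ℕ} (R t₀ : ℝ) (x₀ : EuclideanSpace ℝ (Fin n)) :
    Set (ℝ × EuclideanSpace ℝ (Fin n)) :=
  {p | (p.1 - t₀) ^ 2 + ‖p.2 - x₀‖ ^ 2 ≤ R ^ 2}

/-- `φ` is of class `C^{1,2}` on the closed ball, i.e. on a neighbourhood of it. -/
def IsC12OnClosedBall {n : ℕ} (φ : ℝ → EuclideanSpace ℝ (Fin n) → ℝ)
    (R t₀ : ℝ) (x₀ : EuclideanSpace ℝ (Fin n)) : Prop :=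
  ∃ U : Set (ℝ × EuclideanSpace ℝ (Fin n)), IsOpen U ∧ stClosedBall R t₀ x₀ ⊆ U ∧ IsC12On φ U

open scoped Classical in
/-- The function equal to `φ` in `B_R(t₀,x₀)` and to `u` outside. -/
def glue {n : ℕ} (φ u : ℝ → EuclideanSpace ℝ (Fin n) → ℝ)
    (R t₀ : ℝ) (x₀ : EuclideanSpace ℝ (Fin n)) : ℝ → EuclideanSpace ℝ (Fin n) → ℝ :=
  fun t x => if (t, x) ∈ stBall R t₀ x₀ then φ t x else u t x

/-- `𝓛u ≤ 0` at `(t₀,x₀)` in the viscosity sense, for `u` on `(0,T] × ℝⁿ`: whenever a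
`C^{1,2}` function `φ` touches `u` strictly from above at `(t₀,x₀)` in
`B_R(t₀,x₀) ∩ (0,T] × ℝⁿ`, the glued function `w` satisfies `𝓛w(t₀,x₀) ≤ 0`. -/
def ViscositySubAt {n : ℕ} (T s : ℝ) (b : EuclideanSpace ℝ (Fin n)) (r : ℝ)
    (I : (EuclideanSpace ℝ (Fin n) → ℝ) → EuclideanSpace ℝ (Fin n) → ℝ)
    (u : ℝ → EuclideanSpace ℝ (Fin n) → ℝ) (t₀ : ℝ) (x₀ : EuclideanSpace ℝ (Fin n)) : Prop :=
  ∀ (φ : ℝ → EuclideanSpace ℝ (Fin n) → ℝ) (R : ℝ), 0 < R → IsC12OnClosedBall φ R t₀ x₀ →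
    u t₀ x₀ = φ t₀ x₀ →
    (∀ t x, (t, x) ∈ stBall R t₀ x₀ → t ∈ Ioc 0 T → (t, x) ≠ (t₀, x₀) → u t x < φ t x) →
    parabolicOp s b r I (glue φ u R t₀ x₀) t₀ x₀ ≤ 0

/-- `𝓛u ≥ 0` at `(t₀,x₀)` in the viscosity sense (test functions touching strictly from below). -/
def ViscositySuperAt {n : ℕ} (T s : ℝ) (b : EuclideanSpace ℝ (Fin n)) (r : ℝ)
    (I : (EuclideanSpace ℝ (Fin n) → ℝ) → EuclideanSpace ℝ (Fin n) → ℝ)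
    (u : ℝ → EuclideanSpace ℝ (Fin n) → ℝ) (t₀ : ℝ) (x₀ : EuclideanSpace ℝ (Fin n)) : Prop :=
  ∀ (φ : ℝ → EuclideanSpace ℝ (Fin n) → ℝ) (R : ℝ), 0 < R → IsC12OnClosedBall φ R t₀ x₀ →
    u t₀ x₀ = φ t₀ x₀ →
    (∀ t x, (t, x) ∈ stBall R t₀ x₀ → t ∈ Ioc 0 T → (t, x) ≠ (t₀, x₀) → φ t x < u t x) →
    0 ≤ parabolicOp s b r I (glue φ u R t₀ x₀) t₀ x₀

/-- Bounded viscosity subsolutions of the obstacle problem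
`min {𝓛u, u - ψ} = 0` in `(0,T] × ℝⁿ`, `u(0,·) = ψ`. Semicontinuity is imposed up to the initial
time, so that the initial condition is attached to the values for `t > 0`. -/
structure IsObstacleSubsolution {n : ℕ} (T s : ℝ) (b : EuclideanSpace ℝ (Fin n)) (r : ℝ)
    (I : (EuclideanSpace ℝ (Fin n) → ℝ) → EuclideanSpace ℝ (Fin n) → ℝ)
    (ψ : EuclideanSpace ℝ (Fin n) → ℝ) (u : ℝ → EuclideanSpace ℝ (Fin n) → ℝ) : Prop where
  usc : UpperSemicontinuousOn (fun p : ℝ × EuclideanSpace ℝ (Fin n) => u p.1 p.2)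
    (Icc 0 T ×ˢ univ)
  bounded : ∃ C : ℝ, ∀ t ∈ Ioc 0 T, ∀ x, |u t x| ≤ C
  visc : ∀ t ∈ Ioc 0 T, ∀ x, ψ x < u t x → ViscositySubAt T s b r I u t x
  init : ∀ x, u 0 x ≤ ψ x

/-- Bounded viscosity supersolutions of the obstacle problem
`min {𝓛u, u - ψ} = 0` in `(0,T] × ℝⁿ`, `u(0,·) = ψ`. -/
structure IsObstacleSupersolution {n : ℕ} (T s : ℝ) (b : EuclideanSpace ℝ (Fin n)) (r : ℝ)
    (I : (EuclideanSpace ℝ (Fin n) → ℝ) → EuclideanSpace ℝ (Fin n) → ℝ)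
    (ψ : EuclideanSpace ℝ (Fin n) → ℝ) (u : ℝ → EuclideanSpace ℝ (Fin n) → ℝ) : Prop where
  lsc : LowerSemicontinuousOn (fun p : ℝ × EuclideanSpace ℝ (Fin n) => u p.1 p.2)
    (Icc 0 T ×ˢ univ)
  bounded : ∃ C : ℝ, ∀ t ∈ Ioc 0 T, ∀ x, |u t x| ≤ C
  above : ∀ t ∈ Ioc 0 T, ∀ x, ψ x ≤ u t x
  visc : ∀ t ∈ Ioc 0 T, ∀ x, ViscositySuperAt T s b r I u t x
  init : ∀ x, ψ x ≤ u 0 x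

/-- Obstacles: nonnegative functions of class `C² ∩ W^{2,∞}`. -/
structure IsObstacle {n : ℕ} (ψ : EuclideanSpace ℝ (Fin n) → ℝ) : Prop where
  nonneg : ∀ x, 0 ≤ ψ x
  contDiff : ContDiff ℝ 2 ψ
  bounded : ∃ C : ℝ, ∀ x, |ψ x| ≤ C ∧ ‖fderiv ℝ ψ x‖ ≤ C ∧ ‖fderiv ℝ (fderiv ℝ ψ) x‖ ≤ C

end

open scoped Topology

open Filter

/-! ### Integrability against the kernels `|z|^{-n-2a}` -/

/-! Suppose `u > v` somewhere. With `k = |r| + 1`, let `m > 0` be the supremum of `e^{-kt}(u - v)`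
and `θ(t) = m e^{kt}` (`exists_exponential_supremum`). Then `θ' - rθ ≥ θ ≥ m`, whatever the sign of
`r`, so a place where `u - v` almost reaches `θ` should contradict the inequality that `u - v`
inherits from the two viscosity inequalities.

As `u` and `v` are only semicontinuous, variables are doubled: `doubled` is maximized, with a slowly
varying bounded localizer `X` keeping the maximizers in a compact set (`exists_forall_doubled_le`).
As `N → ∞` they accumulate on the diagonal. The limit time is positive because `u ≤ ψ ≤ v`
initially. At late maximizers `u > ψ`, since otherwise `u - v ≤ ψ(x₁) - ψ(x₂)` would be small; hence
both viscosity inequalities are available.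

The heart is `doubling_inequality`. Moving both points by the same `z` leaves the penalty unchanged,
so maximality gives `δu(x₁,z) - δv(x₂,z) ≤ δX(x₁,z)`, with no trace of `N`. Inside a ball of radius
`R` the test functions replace `u` and `v` and cost `O(N|z|²)`, whose integral vanishes as `R → 0`
with `N` fixed, because both orders `2s` and `2σ` are below 2. Thus no matrix inequality for second
derivatives is needed. Translation invariance brings the two values of `I` to one point, where
ellipticity bounds their difference by `M⁺`. What is left is an error from `X` alone, which tends to
0 with its scale `κ` (`exists_small_localizer`). -/

/-- In polar coordinates the integrand is `y^{1-2a}` on `(0,1]` and `y^{-1-2a}` beyond, integrable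
because `0 < a < 1`. It is applied with both `a = s` and `a = σ`. -/
lemma integrable_truncated_kernel {n : ℕ} (hn : n ≠ 0) {a : ℝ} (ha : 0 < a) (ha1 : a < 1) :
    Integrable (fun z : EuclideanSpace ℝ (Fin n) =>
      min (‖z‖ ^ 2) 1 / ‖z‖ ^ ((n : ℝ) + 2 * a)) := by
  have : NeZero n := ⟨hn⟩
  have : Nontrivial (EuclideanSpace ℝ (Fin n)) := by
    have : Nonempty (Fin n) := ⟨0⟩
    infer_instance
  rw [integrable_fun_norm_addHaar (μ := volume)
    (f := fun y : ℝ => min (y ^ 2) 1 / y ^ ((n : ℝ) + 2 * a))]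
  have hpow : ∀ y : ℝ, 0 < y → y ^ (n - 1) = y ^ ((n : ℝ) - 1) := by
    intro y _
    rw [← Real.rpow_natCast, Nat.cast_sub (Nat.one_le_iff_ne_zero.mpr hn), Nat.cast_one]
  rw [finrank_euclideanSpace_fin, ← Ioc_union_Ioi_eq_Ioi (zero_le_one' ℝ)]
  refine IntegrableOn.union ?_ ?_
  · have h := (intervalIntegral.intervalIntegrable_rpow' (a := 0) (b := 1)
      (show -1 < 1 - 2 * a by linarith)).1
    refine h.congr_fun ?_ measurableSet_Ioc
    intro y hy
    have hy0 : 0 < y := hy.1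
    simp only [smul_eq_mul]
    rw [min_eq_left (by nlinarith [hy.2] : y ^ 2 ≤ 1), hpow y hy0, ← Real.rpow_natCast y 2,
      mul_div_assoc', ← Real.rpow_add hy0, ← Real.rpow_sub hy0]
    congr 1
    push_cast
    ring
  · have h := integrableOn_Ioi_rpow_of_lt (show -1 - 2 * a < -1 by linarith) one_pos
    refine h.congr_fun ?_ measurableSet_Ioi
    intro y hy
    have hy1 : (1 : ℝ) < y := hy
    have hy0 : 0 < y := by linarith
    simp only [smul_eq_mul]
    rw [min_eq_right (by nlinarith : (1 : ℝ) ≤ y ^ 2), hpow y hy0, mul_one_div,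
      ← Real.rpow_sub hy0]
    congr 1
    ring

lemma integrable_div_kernel {n : ℕ} (hn : n ≠ 0) {a : ℝ} (ha : 0 < a) (ha1 : a < 1)
    {g : EuclideanSpace ℝ (Fin n) → ℝ} (hg : Measurable g) {M : ℝ}
    (hM : ∀ z, |g z| ≤ M * min (‖z‖ ^ 2) 1) :
    Integrable (fun z => g z / ‖z‖ ^ ((n : ℝ) + 2 * a)) := by
  refine ((integrable_truncated_kernel hn ha ha1).const_mul M).mono'
    (Measurable.aestronglyMeasurable (by fun_prop)) (Eventually.of_forall fun z => ?_)
  have h0 : 0 ≤ ‖z‖ ^ ((n : ℝ) + 2 * a) := by positivity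
  rw [Real.norm_eq_abs, abs_div, abs_of_nonneg h0, ← mul_div_assoc]
  exact div_le_div_of_nonneg_right (hM z) h0

/-- Dominated convergence; this makes the nonlocal error of the localizer small. -/
lemma tendsto_integral_truncated {n : ℕ} (hn : n ≠ 0) {a : ℝ} (ha : 0 < a) (ha1 : a < 1) :
    Tendsto (fun κ : ℝ => ∫ z : EuclideanSpace ℝ (Fin n),
      min ((κ * ‖z‖) ^ 2) 1 / ‖z‖ ^ ((n : ℝ) + 2 * a)) (𝓝[>] 0) (𝓝 0) := by
  suffices h : Tendsto (fun κ : ℝ => ∫ z : EuclideanSpace ℝ (Fin n),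
      min ((κ * ‖z‖) ^ 2) 1 / ‖z‖ ^ ((n : ℝ) + 2 * a)) (𝓝[>] 0)
      (𝓝 (∫ _ : EuclideanSpace ℝ (Fin n), (0 : ℝ))) by
    rwa [integral_zero] at h
  have hev : ∀ᶠ κ : ℝ in 𝓝[>] 0, 0 < κ ∧ κ < 1 := Ioo_mem_nhdsGT one_pos
  refine tendsto_integral_filter_of_dominated_convergence
    (fun z : EuclideanSpace ℝ (Fin n) => min (‖z‖ ^ 2) 1 / ‖z‖ ^ ((n : ℝ) + 2 * a))
    (Eventually.of_forall fun κ => Measurable.aestronglyMeasurable (by fun_prop)) ?_ (integrable_truncated_kernel hn ha ha1)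
    (Eventually.of_forall fun z => ?_)
  · filter_upwards [hev] with κ hκ
    refine Eventually.of_forall fun z => ?_
    have h0 : 0 ≤ ‖z‖ ^ ((n : ℝ) + 2 * a) := by positivity
    rw [Real.norm_eq_abs, abs_of_nonneg (div_nonneg (by positivity) h0)]
    refine div_le_div_of_nonneg_right (min_le_min_right _ ?_) h0
    exact pow_le_pow_left₀ (by have := hκ.1; positivity)
      (mul_le_of_le_one_left (norm_nonneg _) hκ.2.le) 2
  · have hc : Continuous fun κ : ℝ => min ((κ * ‖z‖) ^ 2) 1 / ‖z‖ ^ ((n : ℝ) + 2 * a) := by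
      fun_prop
    have := hc.tendsto 0
    simp only [zero_mul, ne_eq, OfNat.ofNat_ne_zero, not_false_eq_true, zero_pow,
      zero_le_one, inf_of_le_left, zero_div] at this
    exact this.mono_left nhdsWithin_le_nhds

/-- Removes the contribution of the test functions when their ball shrinks. -/
lemma tendsto_integral_localized {n : ℕ} (hn : n ≠ 0) {a : ℝ} (ha : 0 < a) (ha1 : a < 1) :
    Tendsto (fun R : ℝ => ∫ z : EuclideanSpace ℝ (Fin n),
      (if ‖z‖ < R then ‖z‖ ^ 2 else 0) / ‖z‖ ^ ((n : ℝ) + 2 * a)) (𝓝[>] 0) (𝓝 0) := by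
  suffices h : Tendsto (fun R : ℝ => ∫ z : EuclideanSpace ℝ (Fin n),
      (if ‖z‖ < R then ‖z‖ ^ 2 else 0) / ‖z‖ ^ ((n : ℝ) + 2 * a)) (𝓝[>] 0)
      (𝓝 (∫ _ : EuclideanSpace ℝ (Fin n), (0 : ℝ))) by
    rwa [integral_zero] at h
  have hev : ∀ᶠ R : ℝ in 𝓝[>] 0, 0 < R ∧ R < 1 := Ioo_mem_nhdsGT one_pos
  refine tendsto_integral_filter_of_dominated_convergence
    (fun z : EuclideanSpace ℝ (Fin n) => min (‖z‖ ^ 2) 1 / ‖z‖ ^ ((n : ℝ) + 2 * a))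
    (Eventually.of_forall fun R => ?_) ?_ (integrable_truncated_kernel hn ha ha1)
    (Eventually.of_forall fun z => ?_)
  · refine Measurable.aestronglyMeasurable (Measurable.div ?_ (by fun_prop))
    exact Measurable.ite (measurableSet_lt measurable_norm measurable_const)
      (by fun_prop) measurable_const
  · filter_upwards [hev] with R hR
    refine Eventually.of_forall fun z => ?_
    have h0 : 0 ≤ ‖z‖ ^ ((n : ℝ) + 2 * a) := by positivity
    rw [Real.norm_eq_abs, abs_of_nonneg (div_nonneg (by positivity) h0)]
    refine div_le_div_of_nonneg_right ?_ h0
    split_ifs with h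
    · exact le_min le_rfl (by nlinarith [norm_nonneg z, hR.2])
    · positivity
  · by_cases hz : z = 0
    · simp [hz]
    · have : ∀ᶠ R : ℝ in 𝓝[>] 0, R < ‖z‖ :=
        nhdsWithin_le_nhds (Iio_mem_nhds (norm_pos_iff.mpr hz))
      refine tendsto_const_nhds.congr' ?_
      filter_upwards [this] with R hR
      simp [not_lt.mpr hR.le]

/-! ### Bounded functions with a second-order expansion at a point -/

/-- `W` is bounded and measurable and has an expansion of order two at `x`. -/
structure BoundedTaylorAt {n : ℕ} (W : EuclideanSpace ℝ (Fin n) → ℝ)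
    (x : EuclideanSpace ℝ (Fin n)) : Prop where
  measurable : Measurable W
  bounded : ∃ C, ∀ y, |W y| ≤ C
  expansion : ∃ p : EuclideanSpace ℝ (Fin n), ∃ M > 0, ∃ ρ > 0, ∀ y, ‖y‖ < ρ →
    |W (x + y) - W x - inner ℝ p y| ≤ M * ‖y‖ ^ 2

/-- The derivative is Lipschitz near `x`, so on the ball of radius `‖y‖` it varies by at most
`K‖y‖`; the mean value inequality supplies the second factor `‖y‖`. -/
lemma exists_quadratic_bound_of_contDiffAt {n : ℕ} {f : EuclideanSpace ℝ (Fin n) → ℝ}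
    {x : EuclideanSpace ℝ (Fin n)} (hf : ContDiffAt ℝ 2 f x) :
    ∃ p : EuclideanSpace ℝ (Fin n), ∃ M > 0, ∃ ρ > 0, ∀ y, ‖y‖ < ρ →
      |f (x + y) - f x - inner ℝ p y| ≤ M * ‖y‖ ^ 2 := by
  have hd : ∀ᶠ z in 𝓝 x, DifferentiableAt ℝ f z :=
    (hf.eventually (by simp)).mono fun z hz => hz.differentiableAt (by simp)
  obtain ⟨K, t, ht, hK⟩ :=
    (hf.fderiv_right (m := 1) (by norm_num)).exists_lipschitzOnWith
  obtain ⟨ρ, hρ, hball⟩ := Metric.mem_nhds_iff.mp (Filter.inter_mem ht hd)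
  refine ⟨(InnerProductSpace.toDual ℝ _).symm (fderiv ℝ f x), K + 1, by positivity, ρ, hρ,
    fun y hy => ?_⟩
  rw [InnerProductSpace.toDual_symm_apply]
  have hsub : Metric.closedBall x ‖y‖ ⊆ Metric.ball x ρ := Metric.closedBall_subset_ball hy
  have hxt : x ∈ t := mem_of_mem_nhds ht
  have hmain := Convex.norm_image_sub_le_of_norm_fderiv_le' (𝕜 := ℝ) (f := f)
    (C := K * ‖y‖) (s := Metric.closedBall x ‖y‖) (x := x) (y := x + y) (φ := fderiv ℝ f x)
    (fun z hz => (hball (hsub hz)).2)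
    (fun z hz => by
      have h1 := hK.norm_sub_le (hball (hsub hz)).1 hxt
      refine h1.trans ?_
      have : ‖z - x‖ ≤ ‖y‖ := by simpa [dist_eq_norm] using hz
      gcongr)
    (convex_closedBall _ _) (by simp) (by simp)
  rw [add_sub_cancel_left, Real.norm_eq_abs] at hmain
  nlinarith [sq_nonneg ‖y‖]

/-- The linear term of the expansion is odd in `z` and cancels in the symmetric difference; away
from 0, boundedness suffices. -/
lemma BoundedTaylorAt.exists_secondDiff_le {n : ℕ} {W : EuclideanSpace ℝ (Fin n) → ℝ}
    {x : EuclideanSpace ℝ (Fin n)} (h : BoundedTaylorAt W x) :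
    ∃ M, ∀ z, |secondDiff W x z| ≤ M * min (‖z‖ ^ 2) 1 := by
  obtain ⟨C, hC⟩ := h.bounded
  obtain ⟨p, M, hM, ρ, hρ, hexp⟩ := h.expansion
  have hC0 : 0 ≤ C := (abs_nonneg _).trans (hC x)
  have hbd : ∀ z, |secondDiff W x z| ≤ 4 * C := by
    intro z
    have h1 := abs_le.mp (hC (x + z))
    have h2 := abs_le.mp (hC (x - z))
    have h3 := abs_le.mp (hC x)
    unfold secondDiff
    rw [abs_le]
    constructor <;> linarith
  -- The three terms serve `‖z‖ < ρ`, `‖z‖ ≥ 1`, and `ρ ≤ ‖z‖ ≤ 1`.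
  refine ⟨2 * M + 4 * C + 4 * C / ρ ^ 2, fun z => ?_⟩
  have hq : 0 ≤ 4 * C / ρ ^ 2 := by positivity
  rcases le_total (‖z‖ ^ 2) 1 with h1 | h1
  · rw [min_eq_left h1]
    by_cases hz : ‖z‖ < ρ
    · have e1 := abs_le.mp (hexp z hz)
      have e2 := abs_le.mp (hexp (-z) (by simpa using hz))
      rw [norm_neg, inner_neg_right, ← sub_eq_add_neg] at e2
      have : |secondDiff W x z| ≤ 2 * M * ‖z‖ ^ 2 := by
        unfold secondDiff
        rw [abs_le]
        constructor <;> linarith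
      nlinarith [sq_nonneg ‖z‖]
    · have hz' : ρ ^ 2 ≤ ‖z‖ ^ 2 := pow_le_pow_left₀ hρ.le (not_lt.mp hz) 2
      have : 4 * C ≤ 4 * C / ρ ^ 2 * ‖z‖ ^ 2 := by
        rw [div_mul_eq_mul_div, le_div_iff₀ (by positivity)]
        exact mul_le_mul_of_nonneg_left hz' (by positivity)
      nlinarith [hbd z, sq_nonneg ‖z‖]
  · rw [min_eq_right h1]
    linarith [hbd z]

lemma integrable_inv_one_add_norm_rpow {n : ℕ} {a : ℝ} (ha : 0 < a) :
    Integrable (fun y : EuclideanSpace ℝ (Fin n) => 1 / (1 + ‖y‖ ^ ((n : ℝ) + 2 * a))) := by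
  set q : ℝ := (n : ℝ) + 2 * a with hq
  have hq0 : 0 < q := by positivity
  have hint : Integrable (fun y : EuclideanSpace ℝ (Fin n) => (1 + ‖y‖) ^ (-q)) :=
    integrable_one_add_norm (by rw [finrank_euclideanSpace_fin]; linarith)
  refine (hint.const_mul (2 ^ q)).mono' (Measurable.aestronglyMeasurable (by fun_prop))
    (Eventually.of_forall fun y => ?_)
  have hy : 0 ≤ ‖y‖ := norm_nonneg y
  have hyq : 0 ≤ ‖y‖ ^ q := by positivity
  have h1 : (1 + ‖y‖) ^ q ≤ 2 ^ q * (1 + ‖y‖ ^ q) := by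
    rcases le_total ‖y‖ 1 with h | h
    · calc (1 + ‖y‖) ^ q ≤ 2 ^ q := Real.rpow_le_rpow (by positivity) (by linarith) hq0.le
        _ ≤ 2 ^ q * (1 + ‖y‖ ^ q) := le_mul_of_one_le_right (by positivity) (by linarith)
    · calc (1 + ‖y‖) ^ q ≤ (2 * ‖y‖) ^ q :=
            Real.rpow_le_rpow (by positivity) (by linarith) hq0.le
        _ = 2 ^ q * ‖y‖ ^ q := Real.mul_rpow (by norm_num) hy
        _ ≤ 2 ^ q * (1 + ‖y‖ ^ q) := by gcongr; linarith
  rw [Real.norm_eq_abs, abs_of_nonneg (by positivity), Real.rpow_neg (by positivity),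
    ← div_eq_mul_inv, div_le_div_iff₀ (by positivity) (by positivity)]
  linarith

lemma BoundedTaylorAt.evaluableAt {n : ℕ} {W : EuclideanSpace ℝ (Fin n) → ℝ}
    {x : EuclideanSpace ℝ (Fin n)} (h : BoundedTaylorAt W x) {σ : ℝ} (hσ : 0 < σ)
    (hσ1 : σ < 1) : EvaluableAt σ W x := by
  obtain ⟨C, hC⟩ := h.bounded
  obtain ⟨p, M, hM, ρ, hρ, hexp⟩ := h.expansion
  -- This choice makes the Hölder exponent `2σ + α` equal to 2.
  refine ⟨⟨2 - 2 * σ, by linarith, Or.inr ⟨by linarith, p, M, hM, ρ, hρ, fun y hy => ?_⟩⟩, ?_⟩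
  · have := hexp y hy
    rwa [show 2 * σ + (2 - 2 * σ) = ((2 : ℕ) : ℝ) by push_cast; ring, Real.rpow_natCast]
  · have hm := h.measurable
    refine ((integrable_inv_one_add_norm_rpow hσ).const_mul C).mono'
      (Measurable.aestronglyMeasurable (by fun_prop)) (Eventually.of_forall fun y => ?_)
    have h0 : 0 < 1 + ‖y‖ ^ ((n : ℝ) + 2 * σ) := by positivity
    rw [Real.norm_eq_abs, abs_div, abs_of_pos h0, mul_one_div]
    exact div_le_div_of_nonneg_right (hC y) h0.le

lemma measurable_secondDiff {n : ℕ} {W : EuclideanSpace ℝ (Fin n) → ℝ} (hW : Measurable W)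
    (x : EuclideanSpace ℝ (Fin n)) : Measurable (secondDiff W x) := by
  unfold secondDiff
  fun_prop

lemma BoundedTaylorAt.translate {n : ℕ} {W : EuclideanSpace ℝ (Fin n) → ℝ}
    {x h : EuclideanSpace ℝ (Fin n)} (hW : BoundedTaylorAt W (x + h)) :
    BoundedTaylorAt (fun y => W (y + h)) x := by
  obtain ⟨C, hC⟩ := hW.bounded
  obtain ⟨p, M, hM, ρ, hρ, hexp⟩ := hW.expansion
  refine ⟨hW.measurable.comp (by fun_prop), ⟨C, fun y => hC _⟩, p, M, hM, ρ, hρ, fun y hy => ?_⟩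
  have := hexp y hy
  rwa [add_right_comm] at this

/-! ### Testing viscosity inequalities with separated functions `α(t) + P(x)` -/

open scoped Classical in
/-- The function equal to `P` in the ball `B_R(x₀)` and to `w` outside. -/
noncomputable def ballGlue {n : ℕ} (P w : EuclideanSpace ℝ (Fin n) → ℝ) (R : ℝ)
    (x₀ : EuclideanSpace ℝ (Fin n)) : EuclideanSpace ℝ (Fin n) → ℝ :=
  fun x => if ‖x - x₀‖ < R then P x else w x

lemma ballGlue_of_lt {n : ℕ} {P w : EuclideanSpace ℝ (Fin n) → ℝ} {R : ℝ}
    {x₀ x : EuclideanSpace ℝ (Fin n)} (h : ‖x - x₀‖ < R) : ballGlue P w R x₀ x = P x :=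
  if_pos h

lemma ballGlue_of_le {n : ℕ} {P w : EuclideanSpace ℝ (Fin n) → ℝ} {R : ℝ}
    {x₀ x : EuclideanSpace ℝ (Fin n)} (h : R ≤ ‖x - x₀‖) : ballGlue P w R x₀ x = w x :=
  if_neg (not_lt.mpr h)

lemma ballGlue_self {n : ℕ} {P w : EuclideanSpace ℝ (Fin n) → ℝ} {R : ℝ}
    {x₀ : EuclideanSpace ℝ (Fin n)} (hR : 0 < R) : ballGlue P w R x₀ x₀ = P x₀ :=
  ballGlue_of_lt (by simpa using hR)

lemma boundedTaylorAt_ballGlue {n : ℕ} {P w : EuclideanSpace ℝ (Fin n) → ℝ} {R : ℝ}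
    {x₀ : EuclideanSpace ℝ (Fin n)} (hR : 0 < R) (hP : ContDiff ℝ 2 P) (hw : Measurable w)
    (hwb : ∃ C, ∀ y, |w y| ≤ C) : BoundedTaylorAt (ballGlue P w R x₀) x₀ := by
  refine ⟨?_, ?_, ?_⟩
  · exact Measurable.ite (measurableSet_lt (by fun_prop) measurable_const)
      hP.continuous.measurable hw
  · obtain ⟨C, hC⟩ := hwb
    obtain ⟨D, hD⟩ := (isCompact_closedBall x₀ R).exists_bound_of_continuousOn
      hP.continuous.continuousOn
    refine ⟨max C D, fun y => ?_⟩
    by_cases h : ‖y - x₀‖ < R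
    · rw [ballGlue_of_lt h]
      exact (hD y (by simpa [dist_eq_norm] using h.le)).trans (le_max_right _ _)
    · rw [ballGlue_of_le (not_lt.mp h)]
      exact (hC y).trans (le_max_left _ _)
  · obtain ⟨p, M, hM, ρ, hρ, h⟩ := exists_quadratic_bound_of_contDiffAt (hP.contDiffAt (x := x₀))
    refine ⟨p, M, hM, min ρ R, lt_min hρ hR, fun y hy => ?_⟩
    rw [ballGlue_self hR, ballGlue_of_lt (by simpa using hy.trans_le (min_le_right _ _))]
    exact h y (hy.trans_le (min_le_left _ _))

lemma isC12OnClosedBall_separated {n : ℕ} {α : ℝ → ℝ} {P : EuclideanSpace ℝ (Fin n) → ℝ}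
    (hα : ContDiff ℝ 1 α) (hP : ContDiff ℝ 2 P) (R t₀ : ℝ) (x₀ : EuclideanSpace ℝ (Fin n)) :
    IsC12OnClosedBall (fun t x => α t + P x) R t₀ x₀ := by
  refine ⟨univ, isOpen_univ, subset_univ _, ?_⟩
  have hαc := hα.continuous
  have hPc := hP.continuous
  have hαd : Differentiable ℝ α := hα.differentiable (by simp)
  have hP1 : ContDiff ℝ 1 (fderiv ℝ P) := hP.fderiv_right (by norm_num)
  have e1 : ∀ x : EuclideanSpace ℝ (Fin n), deriv (fun τ => α τ + P x) = deriv α := by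
    intro x
    funext t
    simp
  have e2 : ∀ t : ℝ, fderiv ℝ (fun x => α t + P x) = fderiv ℝ P := by
    intro t
    funext x
    simp
  simp only [IsC12On, e1, e2]
  refine ⟨by fun_prop, fun p _ => by fun_prop, ?_, fun p _ => ?_, ?_, ?_⟩
  · exact ((hα.continuous_deriv le_rfl).comp continuous_fst).continuousOn
  · exact (contDiff_const.add hP).contDiffAt
  · exact (hP1.continuous.comp continuous_snd).continuousOn
  · exact ((hP1.continuous_fderiv one_ne_zero).comp continuous_snd).continuousOn

/-- Local derivatives see only the test function, and the slice at time `t₀` of the space-time ball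
is the spatial ball of the same radius; only the nonlocal terms feel the gluing. -/
lemma parabolicOp_glue_separated {n : ℕ} (s : ℝ) (b : EuclideanSpace ℝ (Fin n)) (r : ℝ)
    (I : (EuclideanSpace ℝ (Fin n) → ℝ) → EuclideanSpace ℝ (Fin n) → ℝ)
    (α : ℝ → ℝ) (P : EuclideanSpace ℝ (Fin n) → ℝ)
    (u : ℝ → EuclideanSpace ℝ (Fin n) → ℝ) {R : ℝ} (hR : 0 < R) (t₀ : ℝ)
    (x₀ : EuclideanSpace ℝ (Fin n)) :
    parabolicOp s b r I (glue (fun t x => α t + P x) u R t₀ x₀) t₀ x₀ =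
      deriv α t₀ + fracLap s (ballGlue (fun x => α t₀ + P x) (u t₀) R x₀) x₀ -
        fderiv ℝ P x₀ b - I (ballGlue (fun x => α t₀ + P x) (u t₀) R x₀) x₀ -
        r * (α t₀ + P x₀) := by
  have hslice : glue (fun t x => α t + P x) u R t₀ x₀ t₀ =
      ballGlue (fun x => α t₀ + P x) (u t₀) R x₀ := by
    funext x
    have : (t₀, x) ∈ stBall R t₀ x₀ ↔ ‖x - x₀‖ < R := by
      simp only [stBall, mem_ofPred_eq, sub_self, ne_eq, OfNat.ofNat_ne_zero, not_false_eq_true,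
        zero_pow, zero_add]
      exact pow_lt_pow_iff_left₀ (norm_nonneg _) hR.le two_ne_zero
    simp only [glue, ballGlue, this]
  have hder : deriv (fun τ => glue (fun t x => α t + P x) u R t₀ x₀ τ x₀) t₀ = deriv α t₀ := by
    have : (fun τ => glue (fun t x => α t + P x) u R t₀ x₀ τ x₀) =ᶠ[𝓝 t₀]
        fun τ => α τ + P x₀ := by
      filter_upwards [Metric.ball_mem_nhds t₀ hR] with τ hτ
      refine if_pos ?_
      simp only [stBall, mem_ofPred_eq, sub_self, norm_zero, ne_eq, OfNat.ofNat_ne_zero,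
        not_false_eq_true, zero_pow, add_zero]
      rw [Metric.mem_ball, Real.dist_eq] at hτ
      exact sq_lt_sq' (abs_lt.mp hτ).1 (abs_lt.mp hτ).2
    rw [this.deriv_eq]
    simp
  have hfder : fderiv ℝ (ballGlue (fun x => α t₀ + P x) (u t₀) R x₀) x₀ = fderiv ℝ P x₀ := by
    have : ballGlue (fun x => α t₀ + P x) (u t₀) R x₀ =ᶠ[𝓝 x₀] fun x => α t₀ + P x := by
      filter_upwards [Metric.ball_mem_nhds x₀ hR] with x hx
      exact ballGlue_of_lt (by simpa [dist_eq_norm] using hx)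
    rw [this.fderiv_eq]
    simp
  unfold parabolicOp
  rw [hder, hslice, hfder, ballGlue_self hR]

lemma contDiff_norm_sub_sq {n : ℕ} {k : WithTop ℕ∞} (x₀ : EuclideanSpace ℝ (Fin n)) :
    ContDiff ℝ k (fun x : EuclideanSpace ℝ (Fin n) => ‖x - x₀‖ ^ 2) :=
  (contDiff_id.sub contDiff_const).norm_sq ℝ

lemma hasFDerivAt_norm_sub_sq {n : ℕ} (x₀ x : EuclideanSpace ℝ (Fin n)) :
    HasFDerivAt (fun x : EuclideanSpace ℝ (Fin n) => ‖x - x₀‖ ^ 2)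
      ((2 : ℕ) • innerSL ℝ (x - x₀)) x := by
  simpa using ((hasFDerivAt_id x).sub_const x₀).norm_sq

lemma separation_pos {n : ℕ} {t t₀ : ℝ} {x x₀ : EuclideanSpace ℝ (Fin n)}
    (h : (t, x) ≠ (t₀, x₀)) : 0 < (t - t₀) ^ 2 + ‖x - x₀‖ ^ 2 := by
  by_contra hc
  have h1 : (t - t₀) ^ 2 = 0 := by nlinarith [sq_nonneg (t - t₀), sq_nonneg ‖x - x₀‖]
  have h2 : ‖x - x₀‖ ^ 2 = 0 := by nlinarith [sq_nonneg (t - t₀), sq_nonneg ‖x - x₀‖]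
  refine h (Prod.ext ?_ ?_)
  · exact sub_eq_zero.mp (pow_eq_zero_iff two_ne_zero |>.mp h1)
  · exact sub_eq_zero.mp (norm_eq_zero.mp (pow_eq_zero_iff two_ne_zero |>.mp h2))

/-- Adding `(t - t₀)² + ‖x - x₀‖²` makes a weak contact strict without changing the value or first
derivatives at the contact point. The spatial square survives only in the glued function. -/
lemma ViscositySubAt.le_of_separated {n : ℕ} {T s : ℝ} {b : EuclideanSpace ℝ (Fin n)} {r : ℝ}
    {I : (EuclideanSpace ℝ (Fin n) → ℝ) → EuclideanSpace ℝ (Fin n) → ℝ}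
    {u : ℝ → EuclideanSpace ℝ (Fin n) → ℝ} {t₀ : ℝ} {x₀ : EuclideanSpace ℝ (Fin n)}
    (h : ViscositySubAt T s b r I u t₀ x₀) {α : ℝ → ℝ} {P : EuclideanSpace ℝ (Fin n) → ℝ}
    (hα : ContDiff ℝ 1 α) (hP : ContDiff ℝ 2 P) (heq : u t₀ x₀ = α t₀ + P x₀)
    (hle : ∀ t ∈ Ioc 0 T, ∀ x, u t x ≤ α t + P x) {R : ℝ} (hR : 0 < R) :
    deriv α t₀ + fracLap s (ballGlue (fun x => α t₀ + P x + ‖x - x₀‖ ^ 2) (u t₀) R x₀) x₀ -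
      fderiv ℝ P x₀ b - I (ballGlue (fun x => α t₀ + P x + ‖x - x₀‖ ^ 2) (u t₀) R x₀) x₀ -
      r * u t₀ x₀ ≤ 0 := by
  have hP2 : ContDiff ℝ 2 (fun x => P x + ‖x - x₀‖ ^ 2) := hP.add (contDiff_norm_sub_sq x₀)
  have hα2 : ContDiff ℝ 1 (fun t => α t + (t - t₀) ^ 2) :=
    hα.add ((contDiff_id.sub contDiff_const).pow 2)
  have key := h (fun t x => (α t + (t - t₀) ^ 2) + (P x + ‖x - x₀‖ ^ 2)) R hR
    (isC12OnClosedBall_separated hα2 hP2 R t₀ x₀) (by simp [heq])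
    (fun t x _ ht hne => by
      have := separation_pos hne
      have := hle t ht x
      linarith)
  rw [parabolicOp_glue_separated s b r I (fun t => α t + (t - t₀) ^ 2)
    (fun x => P x + ‖x - x₀‖ ^ 2) u hR t₀ x₀] at key
  have hd : deriv (fun t => α t + (t - t₀) ^ 2) t₀ = deriv α t₀ := by
    have h1 := (hα.differentiable (by simp) t₀).hasDerivAt.add
      (((hasDerivAt_id t₀).sub_const t₀).pow 2)
    exact h1.deriv.trans (by simp)
  have hf : fderiv ℝ (fun x => P x + ‖x - x₀‖ ^ 2) x₀ = fderiv ℝ P x₀ := by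
    have h1 := (hP.differentiable (by simp) x₀).hasFDerivAt.add (hasFDerivAt_norm_sub_sq x₀ x₀)
    exact h1.fderiv.trans (by simp)
  simp only [hd, hf, sub_self, norm_zero, ne_eq, OfNat.ofNat_ne_zero, not_false_eq_true,
    zero_pow, add_zero, ← heq, ← add_assoc] at key
  exact key

lemma ViscositySuperAt.le_of_separated {n : ℕ} {T s : ℝ} {b : EuclideanSpace ℝ (Fin n)} {r : ℝ}
    {I : (EuclideanSpace ℝ (Fin n) → ℝ) → EuclideanSpace ℝ (Fin n) → ℝ}
    {v : ℝ → EuclideanSpace ℝ (Fin n) → ℝ} {t₀ : ℝ} {x₀ : EuclideanSpace ℝ (Fin n)}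
    (h : ViscositySuperAt T s b r I v t₀ x₀) {α : ℝ → ℝ} {P : EuclideanSpace ℝ (Fin n) → ℝ}
    (hα : ContDiff ℝ 1 α) (hP : ContDiff ℝ 2 P) (heq : v t₀ x₀ = α t₀ + P x₀)
    (hle : ∀ t ∈ Ioc 0 T, ∀ x, α t + P x ≤ v t x) {R : ℝ} (hR : 0 < R) :
    0 ≤ deriv α t₀ + fracLap s (ballGlue (fun x => α t₀ + P x - ‖x - x₀‖ ^ 2) (v t₀) R x₀) x₀ -
      fderiv ℝ P x₀ b - I (ballGlue (fun x => α t₀ + P x - ‖x - x₀‖ ^ 2) (v t₀) R x₀) x₀ -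
      r * v t₀ x₀ := by
  have hP2 : ContDiff ℝ 2 (fun x => P x - ‖x - x₀‖ ^ 2) := hP.sub (contDiff_norm_sub_sq x₀)
  have hα2 : ContDiff ℝ 1 (fun t => α t - (t - t₀) ^ 2) :=
    hα.sub ((contDiff_id.sub contDiff_const).pow 2)
  have key := h (fun t x => (α t - (t - t₀) ^ 2) + (P x - ‖x - x₀‖ ^ 2)) R hR
    (isC12OnClosedBall_separated hα2 hP2 R t₀ x₀) (by simp [heq])
    (fun t x _ ht hne => by
      have := separation_pos hne
      have := hle t ht x
      linarith)
  rw [parabolicOp_glue_separated s b r I (fun t => α t - (t - t₀) ^ 2)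
    (fun x => P x - ‖x - x₀‖ ^ 2) v hR t₀ x₀] at key
  have hd : deriv (fun t => α t - (t - t₀) ^ 2) t₀ = deriv α t₀ := by
    have h1 := (hα.differentiable (by simp) t₀).hasDerivAt.sub
      (((hasDerivAt_id t₀).sub_const t₀).pow 2)
    exact h1.deriv.trans (by simp)
  have hf : fderiv ℝ (fun x => P x - ‖x - x₀‖ ^ 2) x₀ = fderiv ℝ P x₀ := by
    have h1 := (hP.differentiable (by simp) x₀).hasFDerivAt.sub (hasFDerivAt_norm_sub_sq x₀ x₀)
    exact h1.fderiv.trans (by simp)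
  simp only [hd, hf, sub_self, norm_zero, ne_eq, OfNat.ofNat_ne_zero, not_false_eq_true,
    zero_pow, sub_zero, ← heq, ← add_sub_assoc] at key
  exact key

/-! ### Comparison of the nonlocal operators at two points -/

lemma fracLapConst_nonneg (n : ℕ) {s : ℝ} (hs : 0 < s) (hs1 : s < 1) :
    0 ≤ fracLapConst n s := by
  unfold fracLapConst
  have h1 : 0 < Real.Gamma ((n : ℝ) / 2 + s) := Real.Gamma_pos_of_pos (by positivity)
  have h2 : 0 < Real.Gamma (1 - s) := Real.Gamma_pos_of_pos (by linarith)
  positivity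

lemma fracLap_sub_fracLap_le {n : ℕ} (hn : n ≠ 0) {s : ℝ} (hs : 0 < s) (hs1 : s < 1)
    {W V g : EuclideanSpace ℝ (Fin n) → ℝ} {x y : EuclideanSpace ℝ (Fin n)}
    (hW : BoundedTaylorAt W x) (hV : BoundedTaylorAt V y) (hg : Measurable g)
    {M : ℝ} (hgM : ∀ z, |g z| ≤ M * min (‖z‖ ^ 2) 1)
    (hle : ∀ z, secondDiff W x z - secondDiff V y z ≤ g z) :
    fracLap s V y - fracLap s W x ≤
      fracLapConst n s / 2 * ∫ z, g z / ‖z‖ ^ ((n : ℝ) + 2 * s) := by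
  obtain ⟨MW, hMW⟩ := hW.exists_secondDiff_le
  obtain ⟨MV, hMV⟩ := hV.exists_secondDiff_le
  have iW := integrable_div_kernel hn hs hs1 (measurable_secondDiff hW.measurable x) hMW
  have iV := integrable_div_kernel hn hs hs1 (measurable_secondDiff hV.measurable y) hMV
  have ig := integrable_div_kernel hn hs hs1 hg hgM
  have h1 : (∫ z, secondDiff W x z / ‖z‖ ^ ((n : ℝ) + 2 * s)) -
      ∫ z, secondDiff V y z / ‖z‖ ^ ((n : ℝ) + 2 * s) ≤ ∫ z, g z / ‖z‖ ^ ((n : ℝ) + 2 * s) := by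
    rw [← integral_sub iW iV]
    refine integral_mono (iW.sub iV) ig fun z => ?_
    simp only [← sub_div]
    exact div_le_div_of_nonneg_right (hle z) (by positivity)
  have h2 := mul_le_mul_of_nonneg_left h1 
    (div_nonneg (fracLapConst_nonneg n hs hs1) zero_le_two)
  unfold fracLap
  linarith

/-- Translating `V` by `y - x` puts both functions at `x`, where the second difference of `W - V(· +
y - x)` is `δW(x,z) - δV(y,z)`. In `M⁺` its positive part is at most `g`, since `g ≥ 0`, and the
negative part is dropped. -/
lemma IsEllipticOperator.sub_le {n : ℕ} (hn : n ≠ 0) {σ lam Lam : ℝ} (hσ : 0 < σ) (hσ1 : σ < 1)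
    (hlam : 0 ≤ lam) (hLam : 0 ≤ Lam)
    {I : (EuclideanSpace ℝ (Fin n) → ℝ) → EuclideanSpace ℝ (Fin n) → ℝ}
    (hI : IsEllipticOperator σ lam Lam I)
    {W V g : EuclideanSpace ℝ (Fin n) → ℝ} {x y : EuclideanSpace ℝ (Fin n)}
    (hW : BoundedTaylorAt W x) (hV : BoundedTaylorAt V y) (hg : Measurable g) (hg0 : ∀ z, 0 ≤ g z)
    {M : ℝ} (hgM : ∀ z, |g z| ≤ M * min (‖z‖ ^ 2) 1)
    (hle : ∀ z, secondDiff W x z - secondDiff V y z ≤ g z) :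
    I W x - I V y ≤ Lam * ∫ z, g z / ‖z‖ ^ ((n : ℝ) + 2 * σ) := by
  have hy : x + (y - x) = y := by abel
  rw [← hy] at hV
  have htr := hI.translation V (y - x) x (hV.evaluableAt hσ hσ1)
  have hell := (hI.elliptic W (fun z => V (z + (y - x))) x (hW.evaluableAt hσ hσ1)
    (hV.translate.evaluableAt hσ hσ1)).2
  rw [htr, hy] at hell
  rw [hy] at hV
  refine hell.trans ?_
  obtain ⟨MW, hMW⟩ := hW.exists_secondDiff_le
  obtain ⟨MV, hMV⟩ := hV.exists_secondDiff_le
  have hsd : ∀ z, secondDiff (fun z => W z - V (z + (y - x))) x z =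
      secondDiff W x z - secondDiff V y z := by
    intro z
    simp only [secondDiff]
    rw [show x + z + (y - x) = y + z by abel, show x - z + (y - x) = y - z by abel, hy]
    ring
  have ig := integrable_div_kernel hn hσ hσ1 hg hgM
  unfold extremalMax
  simp only [hsd]
  rw [← integral_const_mul]
  have mW := measurable_secondDiff hW.measurable x
  have mV := measurable_secondDiff hV.measurable y
  refine integral_mono ?_ (ig.const_mul Lam) fun z => ?_
  · refine integrable_div_kernel hn hσ hσ1 (M := (Lam + lam) * (MW + MV)) ?_ fun z => ?_
    · fun_prop
    · have habs : |secondDiff W x z - secondDiff V y z| ≤ (MW + MV) * min (‖z‖ ^ 2) 1 := by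
        have := abs_sub (secondDiff W x z) (secondDiff V y z)
        linarith [hMW z, hMV z]
      set d := secondDiff W x z - secondDiff V y z
      have h1 : max d 0 ≤ |d| := max_le (le_abs_self _) (abs_nonneg _)
      have h2 : max (-d) 0 ≤ |d| := max_le (neg_le_abs _) (abs_nonneg _)
      have h3 : 0 ≤ max d 0 := le_max_right _ _
      have h4 : 0 ≤ max (-d) 0 := le_max_right _ _
      have h5 : |Lam * max d 0 - lam * max (-d) 0| ≤ (Lam + lam) * |d| := by
        rw [abs_le]
        constructor <;> nlinarith [abs_nonneg d]
      calc _ ≤ (Lam + lam) * |d| := h5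
        _ ≤ (Lam + lam) * ((MW + MV) * min (‖z‖ ^ 2) 1) := by gcongr
        _ = _ := by ring
  · simp only [← mul_div_assoc]
    refine div_le_div_of_nonneg_right ?_ (by positivity)
    have h1 : max (secondDiff W x z - secondDiff V y z) 0 ≤ g z := max_le (hle z) (hg0 z)
    have h2 : 0 ≤ max (-(secondDiff W x z - secondDiff V y z)) 0 := le_max_right _ _
    nlinarith [mul_le_mul_of_nonneg_left h1 hLam, mul_nonneg hlam h2]

/-! ### The inequality at a maximum of the doubled functional -/

lemma norm_add_sq_add_norm_sub_sq {n : ℕ} (a z : EuclideanSpace ℝ (Fin n)) :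
    ‖a + z‖ ^ 2 + ‖a - z‖ ^ 2 = 2 * ‖a‖ ^ 2 + 2 * ‖z‖ ^ 2 := by
  have := parallelogram_law_with_norm ℝ a z
  linarith

/-- The functional `u(t,x) - v(τ,y) - θ(t) - N/2 (|x-y|² + (t-τ)²) - X(x)` of the doubling of
variables. -/
noncomputable def doubled {n : ℕ} (u v : ℝ → EuclideanSpace ℝ (Fin n) → ℝ) (θ : ℝ → ℝ)
    (X : EuclideanSpace ℝ (Fin n) → ℝ) (N : ℝ) (t τ : ℝ) (x y : EuclideanSpace ℝ (Fin n)) : ℝ :=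
  u t x - v τ y - θ t - N / 2 * (‖x - y‖ ^ 2 + (t - τ) ^ 2) - X x

section Doubling

variable {n : ℕ} {u v : ℝ → EuclideanSpace ℝ (Fin n) → ℝ} {θ : ℝ → ℝ}
  {X : EuclideanSpace ℝ (Fin n) → ℝ} {N t₁ t₂ : ℝ} {x₁ x₂ : EuclideanSpace ℝ (Fin n)}

/-- Outside the ball, add the maximality inequalities at `(x₁ ± z, x₂ ± z)`: the penalty depends
only on `x - y` and cancels. Inside, each quadratic penalty contributes `N‖z‖²` and each strictness
term `2‖z‖²`, hence `2N + 4`. -/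
lemma secondDiff_ballGlue_sub_le {c d R : ℝ} (hR : 0 < R)
    (hW : u t₁ x₁ = c + (N / 2 * ‖x₁ - x₂‖ ^ 2 + X x₁))
    (hV : v t₂ x₂ = d + -(N / 2 * ‖x₂ - x₁‖ ^ 2))
    (hmax : ∀ x y, doubled u v θ X N t₁ t₂ x y ≤ doubled u v θ X N t₁ t₂ x₁ x₂)
    {g : EuclideanSpace ℝ (Fin n) → ℝ} (hX : ∀ z, secondDiff X x₁ z ≤ g z)
    (z : EuclideanSpace ℝ (Fin n)) :
    secondDiff (ballGlue (fun x => c + (N / 2 * ‖x - x₂‖ ^ 2 + X x) + ‖x - x₁‖ ^ 2)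
      (u t₁) R x₁) x₁ z -
    secondDiff (ballGlue (fun y => d + -(N / 2 * ‖y - x₁‖ ^ 2) - ‖y - x₂‖ ^ 2)
      (v t₂) R x₂) x₂ z ≤ g z + (2 * N + 4) * (if ‖z‖ < R then ‖z‖ ^ 2 else 0) := by
  have hXz := hX z
  unfold secondDiff at hXz ⊢
  rw [ballGlue_self hR, ballGlue_self hR]
  by_cases hz : ‖z‖ < R
  · rw [if_pos hz, ballGlue_of_lt (x := x₁ + z) (by simpa using hz),
      ballGlue_of_lt (x := x₁ - z) (by simpa using hz),
      ballGlue_of_lt (x := x₂ + z) (by simpa using hz),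
      ballGlue_of_lt (x := x₂ - z) (by simpa using hz)]
    have p1 := norm_add_sq_add_norm_sub_sq (x₁ - x₂) z
    have p2 := norm_add_sq_add_norm_sub_sq (x₂ - x₁) z
    rw [show x₁ - x₂ + z = x₁ + z - x₂ by abel, show x₁ - x₂ - z = x₁ - z - x₂ by abel] at p1
    rw [show x₂ - x₁ + z = x₂ + z - x₁ by abel, show x₂ - x₁ - z = x₂ - z - x₁ by abel] at p2
    simp only [add_sub_cancel_left, sub_self, norm_zero, sub_sub_cancel_left, norm_neg]
    linear_combination hXz + N / 2 * p1 + N / 2 * p2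
  · rw [if_neg hz, ballGlue_of_le (x := x₁ + z) (by simpa using hz),
      ballGlue_of_le (x := x₁ - z) (by simpa using hz),
      ballGlue_of_le (x := x₂ + z) (by simpa using hz),
      ballGlue_of_le (x := x₂ - z) (by simpa using hz)]
    have m1 := hmax (x₁ + z) (x₂ + z)
    have m2 := hmax (x₁ - z) (x₂ - z)
    unfold doubled at m1 m2
    rw [add_sub_add_right_eq_sub] at m1
    rw [sub_sub_sub_cancel_right] at m2
    simp only [sub_self, norm_zero]
    rw [← hW, ← hV]
    linarith

/-- The bound does not involve `N` explicitly: the penalty's first derivatives agree on both sides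
and its second differences disappear as `R → 0`. -/
theorem doubling_inequality (hn : n ≠ 0) {T s σ lam Lam r : ℝ} (hs : 0 < s) (hs1 : s < 1)
    (hσ : 0 < σ) (hσ1 : σ < 1) (hlam : 0 ≤ lam) (hLam : 0 ≤ Lam)
    {b : EuclideanSpace ℝ (Fin n)}
    {I : (EuclideanSpace ℝ (Fin n) → ℝ) → EuclideanSpace ℝ (Fin n) → ℝ}
    (hI : IsEllipticOperator σ lam Lam I)
    (hum : Measurable (u t₁)) (hub : ∃ C, ∀ x, |u t₁ x| ≤ C)
    (hvm : Measurable (v t₂)) (hvb : ∃ C, ∀ x, |v t₂ x| ≤ C)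
    (hu : ViscositySubAt T s b r I u t₁ x₁) (hv : ViscositySuperAt T s b r I v t₂ x₂)
    (ht₁ : t₁ ∈ Ioc 0 T) (ht₂ : t₂ ∈ Ioc 0 T) (hθ : ContDiff ℝ 1 θ) (hXc : ContDiff ℝ 2 X)
    (hN : 0 ≤ N)
    (hmax : ∀ t ∈ Ioc 0 T, ∀ τ ∈ Ioc 0 T, ∀ x y,
      doubled u v θ X N t τ x y ≤ doubled u v θ X N t₁ t₂ x₁ x₂)
    {g : EuclideanSpace ℝ (Fin n) → ℝ} (hg : Measurable g) (hg0 : ∀ z, 0 ≤ g z)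
    {M : ℝ} (hgM : ∀ z, |g z| ≤ M * min (‖z‖ ^ 2) 1)
    (hX : ∀ z, secondDiff X x₁ z ≤ g z) :
    deriv θ t₁ - fderiv ℝ X x₁ b - r * (u t₁ x₁ - v t₂ x₂) ≤
      fracLapConst n s / 2 * (∫ z, g z / ‖z‖ ^ ((n : ℝ) + 2 * s)) +
        Lam * ∫ z, g z / ‖z‖ ^ ((n : ℝ) + 2 * σ) := by
  set c : ℝ := u t₁ x₁ - N / 2 * ‖x₁ - x₂‖ ^ 2 - X x₁ with hc
  set d : ℝ := v t₂ x₂ + N / 2 * ‖x₂ - x₁‖ ^ 2 with hd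
  have hW : u t₁ x₁ = c + (N / 2 * ‖x₁ - x₂‖ ^ 2 + X x₁) := by rw [hc]; ring
  have hV : v t₂ x₂ = d + -(N / 2 * ‖x₂ - x₁‖ ^ 2) := by rw [hd]; ring
  -- The additive constants in `α` and `β` only normalize `α(t₁) = c` and `β(t₂) = d`, so that the
  -- test functions touch.
  set α : ℝ → ℝ := fun t => θ t + N / 2 * (t - t₂) ^ 2 +
    (c - θ t₁ - N / 2 * (t₁ - t₂) ^ 2) with hα
  set β : ℝ → ℝ := fun t => -(N / 2 * (t - t₁) ^ 2) + (d + N / 2 * (t₂ - t₁) ^ 2) with hβ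
  set P : EuclideanSpace ℝ (Fin n) → ℝ := fun x => N / 2 * ‖x - x₂‖ ^ 2 + X x with hP
  set Q : EuclideanSpace ℝ (Fin n) → ℝ := fun y => -(N / 2 * ‖y - x₁‖ ^ 2) with hQ
  have hα1 : α t₁ = c := by rw [hα]; ring
  have hβ1 : β t₂ = d := by rw [hβ]; ring
  have hαc : ContDiff ℝ 1 α := by rw [hα]; fun_prop
  have hβc : ContDiff ℝ 1 β := by rw [hβ]; fun_prop
  have hPc : ContDiff ℝ 2 P := (contDiff_const.mul (contDiff_norm_sub_sq x₂)).add hXc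
  have hQc : ContDiff ℝ 2 Q := (contDiff_const.mul (contDiff_norm_sub_sq x₁)).neg
  -- The penalty gives `N(t₁ - t₂)` in both time derivatives and `N⟨x₁ - x₂, b⟩` in both drifts, so
  -- both cancel on subtraction.
  have hdα : deriv α t₁ = deriv θ t₁ + N * (t₁ - t₂) := by
    have h1 := (((hθ.differentiable (by simp) t₁).hasDerivAt).add
      ((((hasDerivAt_id t₁).sub_const t₂).pow 2).const_mul (N / 2))).add_const
        (c - θ t₁ - N / 2 * (t₁ - t₂) ^ 2)
    refine h1.deriv.trans ?_
    simp
    ring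
  have hdβ : deriv β t₂ = -(N * (t₂ - t₁)) := by
    have h1 := ((((hasDerivAt_id t₂).sub_const t₁).pow 2).const_mul (N / 2)).neg.add_const
        (d + N / 2 * (t₂ - t₁) ^ 2)
    refine h1.deriv.trans ?_
    simp
    ring
  have hfP : fderiv ℝ P x₁ b = N * inner ℝ (x₁ - x₂) b + fderiv ℝ X x₁ b := by
    have h1 := ((hasFDerivAt_norm_sub_sq x₂ x₁).const_mul (N / 2)).add
      (hXc.differentiable (by simp) x₁).hasFDerivAt
    rw [show fderiv ℝ P x₁ = _ from h1.fderiv]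
    simp only [add_apply, smul_apply, innerSL_apply_apply,
      smul_eq_mul, nsmul_eq_mul]
    push_cast
    ring
  have hfQ : fderiv ℝ Q x₂ b = N * inner ℝ (x₁ - x₂) b := by
    have h1 := ((hasFDerivAt_norm_sub_sq x₁ x₂).const_mul (N / 2)).neg
    rw [show fderiv ℝ Q x₂ = _ from h1.fderiv, ← neg_sub x₂ x₁, inner_neg_left]
    simp only [neg_apply, smul_apply, innerSL_apply_apply,
      smul_eq_mul, nsmul_eq_mul]
    push_cast
    ring
  -- Freezing `(τ, y) = (t₂, x₂)` in the maximality turns it into contact from above for `u`;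
  -- freezing `(t, x)` gives contact from below for `v`.
  have hsub : ∀ R : ℝ, 0 < R → _ := fun R hR =>
    hu.le_of_separated hαc hPc (by rw [hα1, hW]) (fun t ht x => by
      have := hmax t ht t₂ ht₂ x x₂
      simp only [doubled] at this
      simp only [hα, hP, hc]
      linarith) hR
  have hsup : ∀ R : ℝ, 0 < R → _ := fun R hR =>
    hv.le_of_separated hβc hQc (by rw [hβ1, hV]) (fun t ht x => by
      have := hmax t₁ ht₁ t ht x₁ x
      simp only [doubled] at this
      rw [norm_sub_rev x₁ x, norm_sub_rev x₁ x₂] at this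
      simp only [hβ, hQ, hd]
      linear_combination this) hR
  have hK : 0 ≤ 2 * N + 4 := by linarith
  have hlocm : ∀ R : ℝ, Measurable fun z : EuclideanSpace ℝ (Fin n) =>
      if ‖z‖ < R then ‖z‖ ^ 2 else 0 := fun R =>
    Measurable.ite (measurableSet_lt measurable_norm measurable_const) (by fun_prop)
      measurable_const
  have hlocb : ∀ R : ℝ, R ≤ 1 → ∀ z : EuclideanSpace ℝ (Fin n),
      |if ‖z‖ < R then ‖z‖ ^ 2 else 0| ≤ 1 * min (‖z‖ ^ 2) 1 := by
    intro R hR z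
    split_ifs with h
    · rw [abs_of_nonneg (by positivity), one_mul]
      exact le_min le_rfl (by nlinarith [norm_nonneg z])
    · rw [abs_zero]
      positivity
  have hsum : ∀ a : ℝ, 0 < a → a < 1 → ∀ R : ℝ, R ≤ 1 →
      ∫ z, (g z + (2 * N + 4) * (if ‖z‖ < R then ‖z‖ ^ 2 else 0)) / ‖z‖ ^ ((n : ℝ) + 2 * a) =
        (∫ z, g z / ‖z‖ ^ ((n : ℝ) + 2 * a)) + (2 * N + 4) *
          ∫ z : EuclideanSpace ℝ (Fin n),
            (if ‖z‖ < R then ‖z‖ ^ 2 else 0) / ‖z‖ ^ ((n : ℝ) + 2 * a) := by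
    intro a ha ha1 R hR
    rw [← integral_const_mul, ← integral_add (integrable_div_kernel hn ha ha1 hg hgM)
      ((integrable_div_kernel hn ha ha1 (hlocm R) (hlocb R hR)).const_mul _)]
    congr 1
    funext z
    ring
  have hfix : ∀ R : ℝ, 0 < R → R ≤ 1 →
      deriv θ t₁ - fderiv ℝ X x₁ b - r * (u t₁ x₁ - v t₂ x₂) ≤
      fracLapConst n s / 2 * ((∫ z, g z / ‖z‖ ^ ((n : ℝ) + 2 * s)) + (2 * N + 4) *
          ∫ z : EuclideanSpace ℝ (Fin n),
            (if ‖z‖ < R then ‖z‖ ^ 2 else 0) / ‖z‖ ^ ((n : ℝ) + 2 * s)) +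
      Lam * ((∫ z, g z / ‖z‖ ^ ((n : ℝ) + 2 * σ)) + (2 * N + 4) *
          ∫ z : EuclideanSpace ℝ (Fin n),
            (if ‖z‖ < R then ‖z‖ ^ 2 else 0) / ‖z‖ ^ ((n : ℝ) + 2 * σ)) := by
    intro R hR hR1
    have h1 := hsub R hR
    have h2 := hsup R hR
    simp only [hα1, hβ1] at h1 h2
    have hle := secondDiff_ballGlue_sub_le hR hW hV (fun x y => hmax t₁ ht₁ t₂ ht₂ x y) hX
    have tW := boundedTaylorAt_ballGlue (x₀ := x₁) hR
      ((contDiff_const (c := c)).add hPc |>.add (contDiff_norm_sub_sq x₁)) hum hub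
    have tV := boundedTaylorAt_ballGlue (x₀ := x₂) hR
      ((contDiff_const (c := d)).add hQc |>.sub (contDiff_norm_sub_sq x₂)) hvm hvb
    have hGm : Measurable fun z : EuclideanSpace ℝ (Fin n) =>
        g z + (2 * N + 4) * (if ‖z‖ < R then ‖z‖ ^ 2 else 0) := hg.add ((hlocm R).const_mul _)
    have hG0 : ∀ z : EuclideanSpace ℝ (Fin n),
        0 ≤ g z + (2 * N + 4) * (if ‖z‖ < R then ‖z‖ ^ 2 else 0) := by
      intro z
      have := hg0 z
      positivity
    have hGb : ∀ z : EuclideanSpace ℝ (Fin n),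
        |g z + (2 * N + 4) * (if ‖z‖ < R then ‖z‖ ^ 2 else 0)| ≤
          (M + (2 * N + 4)) * min (‖z‖ ^ 2) 1 := by
      intro z
      have e1 := hgM z
      have e2 := mul_le_mul_of_nonneg_left (hlocb R hR1 z) hK
      have e3 := abs_add_le (g z) ((2 * N + 4) * (if ‖z‖ < R then ‖z‖ ^ 2 else 0))
      rw [abs_mul, abs_of_nonneg hK] at e3
      linarith
    have f1 := fracLap_sub_fracLap_le hn hs hs1 tW tV hGm hGb hle
    have f2 := hI.sub_le hn hσ hσ1 hlam hLam tW tV hGm hG0 hGb hle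
    rw [hsum s hs hs1 R hR1] at f1
    rw [hsum σ hσ hσ1 R hR1] at f2
    rw [hdα, hfP] at h1
    rw [hdβ, hfQ] at h2
    linarith
  -- Now `R → 0` with `N` fixed.
  have l1 := tendsto_integral_localized hn hs hs1
  have l2 := tendsto_integral_localized hn hσ hσ1
  have lim := (((l1.const_mul (2 * N + 4)).const_add
    (∫ z, g z / ‖z‖ ^ ((n : ℝ) + 2 * s))).const_mul (fracLapConst n s / 2)).add
    (((l2.const_mul (2 * N + 4)).const_add
    (∫ z, g z / ‖z‖ ^ ((n : ℝ) + 2 * σ))).const_mul Lam)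
  simp only [mul_zero, add_zero] at lim
  refine ge_of_tendsto lim ?_
  filter_upwards [Ioo_mem_nhdsGT one_pos] with R hR
  exact hfix R hR.1 hR.2.le

end Doubling

/-! ### The localizing function -/

/-- The bounded function `A (κ|x|)² / (1 + (κ|x|)²)`, which is at least `A / 2` for `κ|x| ≥ 1`. -/
noncomputable def localizer {n : ℕ} (A κ : ℝ) (x : EuclideanSpace ℝ (Fin n)) : ℝ :=
  A * (1 - (1 + (κ * ‖x‖) ^ 2)⁻¹)

lemma localizer_eq {n : ℕ} (A κ : ℝ) :
    localizer (n := n) A κ = fun x => A * (1 - (1 + κ ^ 2 * ‖x - 0‖ ^ 2)⁻¹) := by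
  funext x
  rw [localizer, mul_pow, sub_zero]

lemma contDiff_localizer {n : ℕ} (A κ : ℝ) : ContDiff ℝ 2 (localizer (n := n) A κ) := by
  rw [localizer_eq]
  refine contDiff_const.mul (contDiff_const.sub (ContDiff.inv ?_ fun x => by positivity))
  exact contDiff_const.add (contDiff_const.mul (contDiff_norm_sub_sq 0))

lemma localizer_nonneg {n : ℕ} {A : ℝ} (hA : 0 ≤ A) (κ : ℝ) (x : EuclideanSpace ℝ (Fin n)) :
    0 ≤ localizer A κ x := by
  have : (1 + (κ * ‖x‖) ^ 2)⁻¹ ≤ 1 := inv_le_one_of_one_le₀ (by nlinarith [sq_nonneg (κ * ‖x‖)])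
  exact mul_nonneg hA (by linarith)

lemma localizer_le {n : ℕ} {A : ℝ} (hA : 0 ≤ A) (κ : ℝ) (x : EuclideanSpace ℝ (Fin n)) :
    localizer A κ x ≤ A := by
  have : 0 ≤ (1 + (κ * ‖x‖) ^ 2)⁻¹ := by positivity
  exact mul_le_of_le_one_right hA (by linarith)

lemma half_le_localizer {n : ℕ} {A κ : ℝ} (hA : 0 ≤ A) {x : EuclideanSpace ℝ (Fin n)}
    (hx : 1 ≤ κ * ‖x‖) : A / 2 ≤ localizer A κ x := by
  have : (1 + (κ * ‖x‖) ^ 2)⁻¹ ≤ 2⁻¹ := inv_anti₀ two_pos (by nlinarith)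
  have := mul_le_mul_of_nonneg_left this hA
  unfold localizer
  linarith

/-- The localizer is a concave function of `‖x‖²`, so it lies below its tangent in that variable,
and by the parallelogram law the two increments of `‖x‖²` add up to `2‖z‖²`. For large `κ‖z‖` the
bounds `0 ≤ X ≤ A` suffice. The estimate is uniform in `x`. -/
lemma secondDiff_localizer_le {n : ℕ} {A : ℝ} (hA : 0 ≤ A) (κ : ℝ)
    (x z : EuclideanSpace ℝ (Fin n)) :
    secondDiff (localizer A κ) x z ≤ 2 * A * min ((κ * ‖z‖) ^ 2) 1 := by
  have hpar := norm_add_sq_add_norm_sub_sq x z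
  have tangent : ∀ p q : ℝ, 0 ≤ p → 0 ≤ q → (1 + q)⁻¹ - (1 + p)⁻¹ ≤ (p - q) / (1 + q) ^ 2 := by
    intro p q hp hq
    have e : (p - q) / (1 + q) ^ 2 - ((1 + q)⁻¹ - (1 + p)⁻¹) =
        (p - q) ^ 2 / ((1 + q) ^ 2 * (1 + p)) := by
      field_simp
      ring
    have : 0 ≤ (p - q) ^ 2 / ((1 + q) ^ 2 * (1 + p)) := by positivity
    linarith
  rcases le_total ((κ * ‖z‖) ^ 2) 1 with h | h
  · rw [min_eq_left h]
    have t1 := tangent ((κ * ‖x + z‖) ^ 2) ((κ * ‖x‖) ^ 2) (by positivity) (by positivity)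
    have t2 := tangent ((κ * ‖x - z‖) ^ 2) ((κ * ‖x‖) ^ 2) (by positivity) (by positivity)
    have hq : 1 ≤ (1 + (κ * ‖x‖) ^ 2) ^ 2 := by nlinarith [sq_nonneg (κ * ‖x‖)]
    have t3 : ((κ * ‖x + z‖) ^ 2 - (κ * ‖x‖) ^ 2) / (1 + (κ * ‖x‖) ^ 2) ^ 2 +
        ((κ * ‖x - z‖) ^ 2 - (κ * ‖x‖) ^ 2) / (1 + (κ * ‖x‖) ^ 2) ^ 2 ≤ 2 * (κ * ‖z‖) ^ 2 := by
      rw [← add_div]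
      have : (κ * ‖x + z‖) ^ 2 - (κ * ‖x‖) ^ 2 + ((κ * ‖x - z‖) ^ 2 - (κ * ‖x‖) ^ 2) =
          2 * (κ * ‖z‖) ^ 2 := by
        linear_combination κ ^ 2 * hpar
      rw [this]
      exact div_le_self (by positivity) hq
    have := mul_le_mul_of_nonneg_left (add_le_add t1 t2 |>.trans t3) hA
    unfold secondDiff localizer
    linarith
  · rw [min_eq_right h]
    have := localizer_nonneg hA κ x
    have := localizer_le hA κ (x + z)
    have := localizer_le hA κ (x - z)
    unfold secondDiff
    linarith

lemma fderiv_localizer_le {n : ℕ} {A κ : ℝ} (hA : 0 ≤ A) (hκ : 0 ≤ κ)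
    (x b : EuclideanSpace ℝ (Fin n)) :
    fderiv ℝ (localizer A κ) x b ≤ A * κ * ‖b‖ := by
  have hpos : 0 < 1 + κ ^ 2 * ‖x - 0‖ ^ 2 := by positivity
  have h0 := ((hasFDerivAt_norm_sub_sq 0 x).const_mul (κ ^ 2)).const_add 1
  have h1 := (((hasDerivAt_inv hpos.ne').comp_hasFDerivAt x h0).const_sub 1).const_mul A
  have h2 : fderiv ℝ (fun x : EuclideanSpace ℝ (Fin n) =>
      A * (1 - (1 + κ ^ 2 * ‖x - 0‖ ^ 2)⁻¹)) x = _ := h1.fderiv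
  rw [localizer_eq, h2]
  simp only [smul_apply, neg_apply, innerSL_apply_apply, smul_eq_mul, nsmul_eq_mul, sub_zero]
  have hib : inner ℝ x b ≤ ‖x‖ * ‖b‖ := real_inner_le_norm x b
  -- With `q = κ‖x‖` this is `2q ≤ 1 + q² ≤ (1 + q²)²`.
  have hsmall : 2 * (κ * ‖x‖) / (1 + κ ^ 2 * ‖x‖ ^ 2) ^ 2 ≤ 1 := by
    rw [div_le_one (by positivity)]
    nlinarith [sq_nonneg (κ * ‖x‖ - 1), sq_nonneg (κ * ‖x‖), sq_nonneg (κ ^ 2 * ‖x‖ ^ 2)]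
  calc _ = A * κ * (2 * κ / (1 + κ ^ 2 * ‖x‖ ^ 2) ^ 2 * inner ℝ x b) := by
        push_cast
        ring
    _ ≤ A * κ * (2 * κ / (1 + κ ^ 2 * ‖x‖ ^ 2) ^ 2 * (‖x‖ * ‖b‖)) := by gcongr
    _ = A * κ * (2 * (κ * ‖x‖) / (1 + κ ^ 2 * ‖x‖ ^ 2) ^ 2 * ‖b‖) := by ring
    _ ≤ A * κ * (1 * ‖b‖) := by gcongr
    _ = A * κ * ‖b‖ := by ring

/-! ### Maxima of the doubled functional -/

/-- Outside the compact set the functional is at most `-1`, the level already reached at `(t₀, x₀)`: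
either `X ≥ C + 1`, or `‖x - y‖ ≥ C + 2` makes the penalty at least `C + 1`. Inside, upper
semicontinuity gives a maximum. -/
lemma exists_forall_doubled_le {n : ℕ} {u v : ℝ → EuclideanSpace ℝ (Fin n) → ℝ} {θ : ℝ → ℝ}
    {X : EuclideanSpace ℝ (Fin n) → ℝ} {T C N ρ : ℝ}
    (hu : UpperSemicontinuousOn (fun p : ℝ × EuclideanSpace ℝ (Fin n) => u p.1 p.2)
      (Icc 0 T ×ˢ univ))
    (hv : LowerSemicontinuousOn (fun p : ℝ × EuclideanSpace ℝ (Fin n) => v p.1 p.2)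
      (Icc 0 T ×ˢ univ))
    (hθ : Continuous θ) (hX : Continuous X) (hN : 1 ≤ N)
    (huC : ∀ t ∈ Icc 0 T, ∀ x, u t x ≤ C) (hv0 : ∀ t ∈ Icc 0 T, ∀ x, 0 ≤ v t x)
    (hθ0 : ∀ t, 0 ≤ θ t) (hX0 : ∀ x, 0 ≤ X x) (hXρ : ∀ x, ρ ≤ ‖x‖ → C + 1 ≤ X x)
    {t₀ : ℝ} {x₀ : EuclideanSpace ℝ (Fin n)} (ht₀ : t₀ ∈ Icc 0 T) (hx₀ : ‖x₀‖ ≤ ρ) (hC : 0 ≤ C)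
    (h₀ : -1 ≤ doubled u v θ X N t₀ t₀ x₀ x₀) :
    ∃ p ∈ (Icc 0 T ×ˢ Icc 0 T) ×ˢ
      (Metric.closedBall (0 : EuclideanSpace ℝ (Fin n)) ρ ×ˢ
        Metric.closedBall (0 : EuclideanSpace ℝ (Fin n)) (ρ + (C + 2))),
      ∀ t ∈ Icc 0 T, ∀ τ ∈ Icc 0 T, ∀ x y,
        doubled u v θ X N t τ x y ≤ doubled u v θ X N p.1.1 p.1.2 p.2.1 p.2.2 := by
  set K := (Icc 0 T ×ˢ Icc 0 T) ×ˢ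
      (Metric.closedBall (0 : EuclideanSpace ℝ (Fin n)) ρ ×ˢ
        Metric.closedBall (0 : EuclideanSpace ℝ (Fin n)) (ρ + (C + 2))) with hKdef
  have hK : IsCompact K := (isCompact_Icc.prod isCompact_Icc).prod
    ((isCompact_closedBall _ _).prod (isCompact_closedBall _ _))
  have hmem : ((t₀, t₀), (x₀, x₀)) ∈ K := by
    refine ⟨⟨ht₀, ht₀⟩, ?_, ?_⟩ <;> simp only [Metric.mem_closedBall, dist_zero_right]
    · exact hx₀
    · linarith
  have husc : UpperSemicontinuousOn (fun p : (ℝ × ℝ) ×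
      (EuclideanSpace ℝ (Fin n) × EuclideanSpace ℝ (Fin n)) =>
      doubled u v θ X N p.1.1 p.1.2 p.2.1 p.2.2) K := by
    have h1 : UpperSemicontinuousOn (fun p : (ℝ × ℝ) ×
        (EuclideanSpace ℝ (Fin n) × EuclideanSpace ℝ (Fin n)) => u p.1.1 p.2.1) K :=
      hu.comp (g := fun p : (ℝ × ℝ) × (EuclideanSpace ℝ (Fin n) × EuclideanSpace ℝ (Fin n)) =>
        (p.1.1, p.2.1)) (by fun_prop) fun p hp => ⟨hp.1.1, mem_univ _⟩
    have h2 : UpperSemicontinuousOn (fun p : (ℝ × ℝ) ×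
        (EuclideanSpace ℝ (Fin n) × EuclideanSpace ℝ (Fin n)) => -v p.1.2 p.2.2) K :=
      hv.neg.comp (g := fun p : (ℝ × ℝ) × (EuclideanSpace ℝ (Fin n) × EuclideanSpace ℝ (Fin n)) =>
        (p.1.2, p.2.2)) (by fun_prop) fun p hp => ⟨hp.1.2, mem_univ _⟩
    have h3 : Continuous (fun p : (ℝ × ℝ) ×
        (EuclideanSpace ℝ (Fin n) × EuclideanSpace ℝ (Fin n)) =>
        -(θ p.1.1 + N / 2 * (‖p.2.1 - p.2.2‖ ^ 2 + (p.1.1 - p.1.2) ^ 2) + X p.2.1)) := by fun_prop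
    have h4 := (h1.add h2).add (h3.upperSemicontinuous.upperSemicontinuousOn K)
    refine (congrArg (UpperSemicontinuousOn · K) ?_).mpr h4
    funext p
    unfold doubled
    ring
  obtain ⟨p, hpK, hp⟩ := husc.exists_isMaxOn ⟨_, hmem⟩ hK
  refine ⟨p, hpK, fun t ht τ hτ x y => ?_⟩
  by_cases hin : ((t, τ), (x, y)) ∈ K
  · exact hp hin
  · have hbase := hp hmem
    simp only [mem_ofPred_eq] at hbase
    refine le_trans ?_ (h₀.trans hbase)
    have e1 := huC t ht x
    have e2 := hv0 τ hτ y
    have e3 := hθ0 t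
    have e4 := hX0 x
    have e5 : 0 ≤ ‖x - y‖ ^ 2 + (t - τ) ^ 2 := by positivity
    unfold doubled
    by_cases hx : ρ ≤ ‖x‖
    · have := hXρ x hx
      have : 0 ≤ N / 2 * (‖x - y‖ ^ 2 + (t - τ) ^ 2) := by positivity
      linarith
    · have hy : C + 2 ≤ ‖x - y‖ := by
        by_contra hc
        refine hin ⟨⟨ht, hτ⟩, ?_, ?_⟩ <;> simp only [Metric.mem_closedBall, dist_zero_right]
        · linarith
        · have : ‖y‖ ≤ ‖x‖ + ‖x - y‖ := by
            simpa using norm_sub_le x (x - y)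
          linarith
      have h6 : 2 * (C + 1) ≤ ‖x - y‖ ^ 2 + (t - τ) ^ 2 := by
        nlinarith [sq_nonneg (t - τ)]
      have h7 : (C + 1) ≤ N / 2 * (‖x - y‖ ^ 2 + (t - τ) ^ 2) := by nlinarith
      linarith

/-! ### The comparison principle -/

lemma exists_exponential_supremum {n : ℕ} {u v : ℝ → EuclideanSpace ℝ (Fin n) → ℝ} {T C k : ℝ}
    (hk : 0 ≤ k) (hC : ∀ t ∈ Ioc 0 T, ∀ x, u t x - v t x ≤ C)
    (hpos : ∃ t ∈ Ioc 0 T, ∃ x, v t x < u t x) :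
    ∃ m > 0, (∀ t ∈ Ioc 0 T, ∀ x, u t x - v t x ≤ m * Real.exp (k * t)) ∧
      ∀ η > 0, ∃ t ∈ Ioc 0 T, ∃ x, m * Real.exp (k * t) - η < u t x - v t x := by
  obtain ⟨t₀, ht₀, x₀, h₀⟩ := hpos
  set S : Set ℝ := {c | ∃ t ∈ Ioc 0 T, ∃ x, c = Real.exp (-(k * t)) * (u t x - v t x)} with hS
  have hne : S.Nonempty := ⟨_, t₀, ht₀, x₀, rfl⟩
  have hC0 : 0 ≤ C := by linarith [hC t₀ ht₀ x₀]
  have hbdd : BddAbove S := by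
    refine ⟨C, ?_⟩
    rintro _ ⟨t, ht, x, rfl⟩
    have h1 : Real.exp (-(k * t)) ≤ 1 :=
      Real.exp_le_one_iff.mpr (neg_nonpos.mpr (mul_nonneg hk ht.1.le))
    have h2 := Real.exp_pos (-(k * t))
    nlinarith [hC t ht x]
  have hcancel : ∀ t : ℝ, Real.exp (-(k * t)) * Real.exp (k * t) = 1 := fun t => by
    rw [← Real.exp_add, neg_add_cancel, Real.exp_zero]
  refine ⟨sSup S, ?_, fun t ht x => ?_, fun η hη => ?_⟩
  · exact (mul_pos (Real.exp_pos (-(k * t₀))) (by linarith)).trans_le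
      (le_csSup hbdd ⟨t₀, ht₀, x₀, rfl⟩)
  · have h1 := mul_le_mul_of_nonneg_right (le_csSup hbdd ⟨t, ht, x, rfl⟩)
      (Real.exp_pos (k * t)).le
    linear_combination h1 - (u t x - v t x) * hcancel t
  -- The slack `η e^{-kT}` is at most `η` after multiplication by `e^{kt}`, since `t ≤ T`.
  · obtain ⟨_, ⟨t, ht, x, rfl⟩, hlt⟩ := exists_lt_of_lt_csSup hne
      (show sSup S - η * Real.exp (-(k * T)) < sSup S by
        have := Real.exp_pos (-(k * T))
        nlinarith)
    refine ⟨t, ht, x, ?_⟩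
    have h1 := mul_lt_mul_of_pos_right hlt (Real.exp_pos (k * t))
    have h2 : Real.exp (-(k * T)) * Real.exp (k * t) ≤ 1 := by
      rw [← Real.exp_add]
      exact Real.exp_le_one_iff.mpr (by nlinarith [ht.2])
    have h3 := mul_le_mul_of_nonneg_left h2 hη.le
    linear_combination h1 + h3 + (u t x - v t x) * hcancel t

/-- The height `A` and the point `x₀` are fixed before `κ`, so one small scale controls the value at
`x₀`, the drift and both nonlocal errors. -/
lemma exists_small_localizer {n : ℕ} (hn : n ≠ 0) {s σ : ℝ} (hs : 0 < s) (hs1 : s < 1)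
    (hσ : 0 < σ) (hσ1 : σ < 1) (A Lam : ℝ) (b x₀ : EuclideanSpace ℝ (Fin n)) {η : ℝ}
    (hη : 0 < η) :
    ∃ κ : ℝ, 0 < κ ∧ κ < 1 ∧ localizer A κ x₀ < η ∧
      A * κ * ‖b‖ + (fracLapConst n s / 2 *
        (∫ z : EuclideanSpace ℝ (Fin n),
          2 * A * min ((κ * ‖z‖) ^ 2) 1 / ‖z‖ ^ ((n : ℝ) + 2 * s)) +
        Lam * ∫ z : EuclideanSpace ℝ (Fin n),
          2 * A * min ((κ * ‖z‖) ^ 2) 1 / ‖z‖ ^ ((n : ℝ) + 2 * σ)) < η := by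
  have l1 : Tendsto (fun κ : ℝ => localizer A κ x₀) (𝓝[>] 0) (𝓝 0) := by
    have hc : Continuous fun κ : ℝ => localizer A κ x₀ := by
      unfold localizer
      refine continuous_const.mul (continuous_const.sub (Continuous.inv₀ (by fun_prop) fun κ => ?_))
      positivity
    have := hc.tendsto 0
    simp only [localizer, zero_mul, ne_eq, OfNat.ofNat_ne_zero, not_false_eq_true, zero_pow,
      add_zero, inv_one, sub_self, mul_zero] at this
    exact this.mono_left nhdsWithin_le_nhds
  have l2 : Tendsto (fun κ : ℝ => A * κ * ‖b‖) (𝓝[>] 0) (𝓝 0) := by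
    have hc : Continuous fun κ : ℝ => A * κ * ‖b‖ := by fun_prop
    have := hc.tendsto 0
    simp only [mul_zero, zero_mul] at this
    exact this.mono_left nhdsWithin_le_nhds
  have l3 : ∀ a : ℝ, 0 < a → a < 1 → Tendsto (fun κ : ℝ => ∫ z : EuclideanSpace ℝ (Fin n),
      2 * A * min ((κ * ‖z‖) ^ 2) 1 / ‖z‖ ^ ((n : ℝ) + 2 * a)) (𝓝[>] 0) (𝓝 0) := by
    intro a ha ha1
    simpa only [mul_div_assoc, integral_const_mul, mul_zero] using
      (tendsto_integral_truncated hn ha ha1).const_mul (2 * A)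
  have l4 := l2.add (((l3 s hs hs1).const_mul (fracLapConst n s / 2)).add
    ((l3 σ hσ hσ1).const_mul Lam))
  simp only [mul_zero, add_zero] at l4
  have hev : ∀ᶠ κ : ℝ in 𝓝[>] 0, 0 < κ ∧ κ < 1 := Ioo_mem_nhdsGT one_pos
  obtain ⟨κ, hκ, h1, h2⟩ :=
    (hev.and ((l1.eventually_lt_const hη).and (l4.eventually_lt_const hη))).exists
  exact ⟨κ, hκ.1, hκ.2, h1, h2⟩

/-- Gives the Borel measurability of time slices required by the nonlocal integrals. -/
lemma upperSemicontinuous_slice {n : ℕ} {u : ℝ → EuclideanSpace ℝ (Fin n) → ℝ} {T t : ℝ}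
    (hu : UpperSemicontinuousOn (fun p : ℝ × EuclideanSpace ℝ (Fin n) => u p.1 p.2)
      (Icc 0 T ×ˢ univ)) (ht : t ∈ Icc 0 T) : UpperSemicontinuous (u t) :=
  upperSemicontinuousOn_univ_iff.mp
    (hu.comp (g := fun x => (t, x)) (t := univ) (by fun_prop) fun _ _ => ⟨ht, mem_univ _⟩)

lemma lowerSemicontinuous_slice {n : ℕ} {u : ℝ → EuclideanSpace ℝ (Fin n) → ℝ} {T t : ℝ}
    (hu : LowerSemicontinuousOn (fun p : ℝ × EuclideanSpace ℝ (Fin n) => u p.1 p.2)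
      (Icc 0 T ×ˢ univ)) (ht : t ∈ Icc 0 T) : LowerSemicontinuous (u t) :=
  lowerSemicontinuousOn_univ_iff.mp
    (hu.comp (g := fun x => (t, x)) (t := univ) (by fun_prop) fun _ _ => ⟨ht, mem_univ _⟩)

/-- Along points of a compact set at which the penalty with weight `N` stays bounded as `N → ∞`,
a subsequence converges to a diagonal point. -/
lemma exists_diagonal_limit {n : ℕ} {K : Set ((ℝ × ℝ) ×
      (EuclideanSpace ℝ (Fin n) × EuclideanSpace ℝ (Fin n)))} (hK : IsCompact K) {B : ℝ}
    {p : ℕ → (ℝ × ℝ) × (EuclideanSpace ℝ (Fin n) × EuclideanSpace ℝ (Fin n))}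
    (hp : ∀ j, p j ∈ K)
    (hB : ∀ j : ℕ, ((j : ℝ) + 1) / 2 *
      (‖(p j).2.1 - (p j).2.2‖ ^ 2 + ((p j).1.1 - (p j).1.2) ^ 2) ≤ B) :
    ∃ (t : ℝ) (x : EuclideanSpace ℝ (Fin n)) (f : ℕ → ℕ), ((t, t), (x, x)) ∈ K ∧
      Tendsto (p ∘ f) atTop (𝓝 ((t, t), (x, x))) := by
  obtain ⟨q, hqK, f, hf, hlim⟩ := hK.tendsto_subseq hp
  have hc : Continuous fun q : (ℝ × ℝ) × (EuclideanSpace ℝ (Fin n) × EuclideanSpace ℝ (Fin n)) =>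
      ‖q.2.1 - q.2.2‖ ^ 2 + (q.1.1 - q.1.2) ^ 2 := by fun_prop
  have h1 := (hc.tendsto q).comp hlim
  have h2 : Tendsto (fun j : ℕ => 2 * B * (1 / ((j : ℝ) + 1))) atTop (𝓝 0) := by
    simpa using tendsto_one_div_add_atTop_nhds_zero_nat.const_mul (2 * B)
  have h3 := le_of_tendsto_of_tendsto' h1 (h2.comp hf.tendsto_atTop) (fun j => by
    have := hB (f j)
    simp only [Function.comp_apply]
    rw [mul_one_div, le_div_iff₀ (by positivity)]
    linarith)
  have h4 : q.1.1 = q.1.2 := by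
    have : (q.1.1 - q.1.2) ^ 2 = 0 := by
      nlinarith [sq_nonneg ‖q.2.1 - q.2.2‖, sq_nonneg (q.1.1 - q.1.2)]
    exact sub_eq_zero.mp (pow_eq_zero_iff two_ne_zero |>.mp this)
  have h5 : q.2.1 = q.2.2 := by
    have : ‖q.2.1 - q.2.2‖ ^ 2 = 0 := by
      nlinarith [sq_nonneg ‖q.2.1 - q.2.2‖, sq_nonneg (q.1.1 - q.1.2)]
    exact sub_eq_zero.mp (norm_eq_zero.mp (pow_eq_zero_iff two_ne_zero |>.mp this))
  have hq : q = ((q.1.1, q.1.1), (q.2.1, q.2.1)) := by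
    conv_lhs => rw [← Prod.mk.eta (p := q), ← Prod.mk.eta (p := q.1), ← Prod.mk.eta (p := q.2),
      ← h4, ← h5]
  exact ⟨q.1.1, q.2.1, f, hq ▸ hqK, hq ▸ hlim⟩

/-- Comparison principle: every bounded viscosity subsolution of the obstacle problem lies below
every bounded viscosity supersolution on `(0,T] × ℝⁿ`. -/
theorem theorem2p12 (n : ℕ) (hn : 2 ≤ n) (T : ℝ) (hT : 0 < T)
    (s : ℝ) (hs : 1 / 2 < s) (hs' : s < 1)
    (σ : ℝ) (hσ : 0 < σ) (hσs : σ < s)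
    (lam Lam : ℝ) (hlam : 0 < lam) (hLam : lam ≤ Lam)
    (b : EuclideanSpace ℝ (Fin n)) (r : ℝ)
    (I : (EuclideanSpace ℝ (Fin n) → ℝ) → EuclideanSpace ℝ (Fin n) → ℝ)
    (hI : IsEllipticOperator σ lam Lam I)
    (ψ : EuclideanSpace ℝ (Fin n) → ℝ) (hψ : IsObstacle ψ)
    (u v : ℝ → EuclideanSpace ℝ (Fin n) → ℝ)
    (hu : IsObstacleSubsolution T s b r I ψ u)
    (hv : IsObstacleSupersolution T s b r I ψ v) :
    ∀ t ∈ Set.Ioc 0 T, ∀ x : EuclideanSpace ℝ (Fin n), u t x ≤ v t x := by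
  have hn0 : n ≠ 0 := by omega
  have hs0 : 0 < s := by linarith
  have hσ1 : σ < 1 := by linarith
  have hLam0 : 0 ≤ Lam := by linarith
  by_contra! hcon
  obtain ⟨Cu, hCu⟩ := hu.bounded
  obtain ⟨Cψ, hCψ⟩ := hψ.bounded
  obtain ⟨C, hC, huC, hv0⟩ : ∃ C, 0 ≤ C ∧ (∀ t ∈ Icc 0 T, ∀ x, u t x ≤ C) ∧
      ∀ t ∈ Icc 0 T, ∀ x, 0 ≤ v t x := by
    refine ⟨max Cu Cψ, le_max_of_le_right ((abs_nonneg _).trans (hCψ 0).1), fun t ht x => ?_,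
      fun t ht x => ?_⟩
    · rcases ht.1.eq_or_lt with rfl | h0
      · exact (hu.init x).trans ((le_abs_self _).trans ((hCψ x).1.trans (le_max_right _ _)))
      · exact (le_abs_self _).trans ((hCu t ⟨h0, ht.2⟩ x).trans (le_max_left _ _))
    · rcases ht.1.eq_or_lt with rfl | h0
      · exact (hψ.nonneg x).trans (hv.init x)
      · exact (hψ.nonneg x).trans (hv.above t ⟨h0, ht.2⟩ x)
  set k : ℝ := |r| + 1 with hk
  have hk0 : 0 ≤ k := by positivity
  obtain ⟨m, hm, hmle, hmnear⟩ := exists_exponential_supremum (C := C) hk0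
    (fun t ht x => by linarith [huC t ⟨ht.1.le, ht.2⟩ x, hv0 t ⟨ht.1.le, ht.2⟩ x]) hcon
  -- The bound `1/2` puts the starting value `-2η` above `-1`; the other gives `η ≤ m/8` and `2|r|η
  -- ≤ m/4`, as `k ≥ 1` and `|r| ≤ k`.
  set η : ℝ := min (1 / 2) (m / (8 * k)) with hη
  have hk1 : 1 ≤ k := by linarith [abs_nonneg r]
  have hη0 : 0 < η := by positivity
  have hη1 : η ≤ 1 / 2 := min_le_left _ _
  have hηk : η * k ≤ m / 8 := by
    have : η ≤ m / (8 * k) := min_le_right _ _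
    rw [le_div_iff₀ (by positivity)] at this
    linarith
  have hηm : η ≤ m / 8 := by nlinarith
  obtain ⟨t₀, ht₀, x₀, hnear⟩ := hmnear η hη0
  -- Half of this height is the barrier `C + 1`, reached where `κ‖x‖ ≥ 1`.
  set A : ℝ := 2 * (C + 1) with hA
  have hA0 : 0 ≤ A := by positivity
  obtain ⟨κ, hκ0, hκ1, hXx₀, herr⟩ :=
    exists_small_localizer hn0 hs0 hs' hσ hσ1 A Lam b x₀ hη0
  set X := localizer (n := n) A κ with hX
  set θ : ℝ → ℝ := fun t => m * Real.exp (k * t) with hθ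
  have hθc : ContDiff ℝ 1 θ := by rw [hθ]; fun_prop
  have hXc : ContDiff ℝ 2 X := contDiff_localizer A κ
  have hX0 : ∀ x, 0 ≤ X x := localizer_nonneg hA0 κ
  have hbase : ∀ N : ℝ, -(2 * η) ≤ doubled u v θ X N t₀ t₀ x₀ x₀ := by
    intro N
    simp only [doubled, hθ, sub_self, norm_zero, ne_eq, OfNat.ofNat_ne_zero, not_false_eq_true,
      zero_pow, add_zero, mul_zero, sub_zero]
    linarith
  have hmaxs := fun j : ℕ => exists_forall_doubled_le (N := (j : ℝ) + 1) (ρ := max ‖x₀‖ κ⁻¹)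
    hu.usc hv.lsc hθc.continuous hXc.continuous
    (by linarith [Nat.cast_nonneg (α := ℝ) j]) huC hv0 (fun t => by positivity) hX0
    (fun x hx => by
      have h1 : 1 ≤ κ * ‖x‖ := by
        rw [← mul_inv_cancel₀ hκ0.ne']
        exact mul_le_mul_of_nonneg_left ((le_max_right _ _).trans hx) hκ0.le
      have := half_le_localizer hA0 h1
      linarith) ⟨ht₀.1.le, ht₀.2⟩ (le_max_left _ _) hC
    (by linarith [hbase ((j : ℝ) + 1)])
  choose p hpK hpmax using hmaxs
  have hval : ∀ j : ℕ, -(2 * η) ≤ doubled u v θ X ((j : ℝ) + 1) (p j).1.1 (p j).1.2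
      (p j).2.1 (p j).2.2 := fun j =>
    (hbase _).trans (hpmax j t₀ ⟨ht₀.1.le, ht₀.2⟩ t₀ ⟨ht₀.1.le, ht₀.2⟩ x₀ x₀)
  have hpen : ∀ j : ℕ, ((j : ℝ) + 1) / 2 *
      (‖(p j).2.1 - (p j).2.2‖ ^ 2 + ((p j).1.1 - (p j).1.2) ^ 2) ≤ C + 1 := by
    intro j
    have h1 := hval j
    have h2 := huC _ (hpK j).1.1 (p j).2.1
    have h3 := hv0 _ (hpK j).1.2 (p j).2.2
    have h4 := hX0 (p j).2.1
    have h5 : 0 ≤ θ (p j).1.1 := by positivity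
    unfold doubled at h1
    linarith
  obtain ⟨t', x', f, hK', hlim⟩ := exists_diagonal_limit ((isCompact_Icc.prod isCompact_Icc).prod
    ((isCompact_closedBall _ _).prod (isCompact_closedBall _ _))) hpK hpen
  have ht' : t' ∈ Icc 0 T := hK'.1.1
  have lt₁ : Tendsto (fun j => (p (f j)).1.1) atTop (𝓝 t') :=
    ((by fun_prop : Continuous fun q : (ℝ × ℝ) × (EuclideanSpace ℝ (Fin n) ×
      EuclideanSpace ℝ (Fin n)) => q.1.1).tendsto _).comp hlim
  have lt₂ : Tendsto (fun j => (p (f j)).1.2) atTop (𝓝 t') :=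
    ((by fun_prop : Continuous fun q : (ℝ × ℝ) × (EuclideanSpace ℝ (Fin n) ×
      EuclideanSpace ℝ (Fin n)) => q.1.2).tendsto _).comp hlim
  have lx₁ : Tendsto (fun j => (p (f j)).2.1) atTop (𝓝 x') :=
    ((by fun_prop : Continuous fun q : (ℝ × ℝ) × (EuclideanSpace ℝ (Fin n) ×
      EuclideanSpace ℝ (Fin n)) => q.2.1).tendsto _).comp hlim
  have lx₂ : Tendsto (fun j => (p (f j)).2.2) atTop (𝓝 x') :=
    ((by fun_prop : Continuous fun q : (ℝ × ℝ) × (EuclideanSpace ℝ (Fin n) ×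
      EuclideanSpace ℝ (Fin n)) => q.2.2).tendsto _).comp hlim
  have lu : Tendsto (fun j => ((p (f j)).1.1, (p (f j)).2.1)) atTop
      (𝓝[Icc 0 T ×ˢ univ] (t', x')) :=
    tendsto_nhdsWithin_iff.mpr ⟨lt₁.prodMk_nhds lx₁, Eventually.of_forall fun j =>
      ⟨(hpK (f j)).1.1, mem_univ _⟩⟩
  have lv : Tendsto (fun j => ((p (f j)).1.2, (p (f j)).2.2)) atTop
      (𝓝[Icc 0 T ×ˢ univ] (t', x')) :=
    tendsto_nhdsWithin_iff.mpr ⟨lt₂.prodMk_nhds lx₂, Eventually.of_forall fun j =>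
      ⟨(hpK (f j)).1.2, mem_univ _⟩⟩
  have eu : ∀ᶠ j in atTop, u (p (f j)).1.1 (p (f j)).2.1 < u t' x' + η / 2 :=
    lu.eventually
      (hu.usc (t', x') ⟨ht', mem_univ _⟩ (u t' x' + η / 2) (by simpa using hη0))
  have ev : ∀ᶠ j in atTop, v t' x' - η / 2 < v (p (f j)).1.2 (p (f j)).2.2 :=
    lv.eventually
      (hv.lsc (t', x') ⟨ht', mem_univ _⟩ (v t' x' - η / 2) (by simpa using hη0))
  have eθ : ∀ᶠ j in atTop, θ t' - η < θ (p (f j)).1.1 :=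
    ((hθc.continuous.tendsto t').comp lt₁).eventually_const_lt (by linarith)
  have eψ : ∀ᶠ j in atTop, ψ (p (f j)).2.1 - ψ (p (f j)).2.2 < η := by
    have hc := hψ.contDiff.continuous
    refine (((hc.tendsto x').comp lx₁).sub ((hc.tendsto x').comp lx₂)).eventually_lt_const ?_
    simpa using hη0
  have hgap : ∀ j, θ (p j).1.1 - 2 * η ≤ u (p j).1.1 (p j).2.1 - v (p j).1.2 (p j).2.2 := by
    intro j
    have h1 := hval j
    have h4 := hX0 (p j).2.1
    have h5 : 0 ≤ ((j : ℝ) + 1) / 2 *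
      (‖(p j).2.1 - (p j).2.2‖ ^ 2 + ((p j).1.1 - (p j).1.2) ^ 2) := by positivity
    unfold doubled at h1
    linarith
  have hθm : ∀ t, 0 ≤ t → m ≤ θ t := fun t ht =>
    le_mul_of_one_le_right hm.le (Real.one_le_exp (mul_nonneg hk0 ht))
  -- At `t' = 0` semicontinuity and `u ≤ ψ ≤ v` would give `u - v < η` at the maximizers, against `u
  -- - v ≥ m - 2η` and `η ≤ m/8`.
  have ht'0 : 0 < t' := by
    rcases ht'.1.eq_or_lt with h0 | h0
    · obtain ⟨j, h1, h2⟩ := (eu.and ev).exists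
      have h3 := hgap (f j)
      have h4 := hθm _ (hpK (f j)).1.1.1
      rw [← h0] at h1 h2
      linarith [hu.init x', hv.init x']
    · exact h0
  obtain ⟨j, h1, h2, h3, h4, h5, h6⟩ := (eu.and (ev.and (eθ.and (eψ.and
    ((lt₁.eventually_const_lt ht'0).and (lt₂.eventually_const_lt ht'0)))))).exists
  set i := f j
  rcases hpi : p i with ⟨⟨t₁, t₂⟩, ⟨x₁, x₂⟩⟩
  have hpKi := hpK i
  have hgapi := hgap i
  have hpmaxi := hpmax i
  simp only [hpi] at h1 h2 h3 h4 h5 h6 hpKi hgapi hpmaxi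
  have ht₁ : t₁ ∈ Ioc 0 T := ⟨h5, hpKi.1.1.2⟩
  have ht₂ : t₂ ∈ Ioc 0 T := ⟨h6, hpKi.1.2.2⟩
  have hθ₁ := hθm t₁ h5.le
  -- Otherwise `u - v ≤ ψ(x₁) - ψ(x₂) < η`, again below `m - 2η`.
  have hcontact : ψ x₁ < u t₁ x₁ := by
    by_contra! hle
    linarith [hv.above t₂ ht₂ x₂]
  have hineq := doubling_inequality hn0 hs0 hs' hσ hσ1 hlam.le hLam0 hI
    (upperSemicontinuous_slice hu.usc ⟨h5.le, ht₁.2⟩).measurable ⟨Cu, hCu t₁ ht₁⟩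
    (lowerSemicontinuous_slice hv.lsc ⟨h6.le, ht₂.2⟩).measurable
    (hv.bounded.imp fun D hD => hD t₂ ht₂) (hu.visc t₁ ht₁ x₁ hcontact) (hv.visc t₂ ht₂ x₂)
    ht₁ ht₂ hθc hXc (N := (i : ℝ) + 1) (by positivity)
    (fun t ht τ hτ x y => hpmaxi t ⟨ht.1.le, ht.2⟩ τ ⟨hτ.1.le, hτ.2⟩ x y)
    (g := fun z => 2 * A * min ((κ * ‖z‖) ^ 2) 1) (by fun_prop) (fun z => by positivity)
    (M := 2 * A) (fun z => by
      rw [abs_of_nonneg (by positivity)]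
      have : (κ * ‖z‖) ^ 2 ≤ ‖z‖ ^ 2 := pow_le_pow_left₀ (by positivity)
        (mul_le_of_le_one_left (norm_nonneg _) hκ1.le) 2
      gcongr)
    (secondDiff_localizer_le hA0 κ x₁)
  have hdθ : deriv θ t₁ = k * θ t₁ := by
    have h7 := (((hasDerivAt_id t₁).const_mul k).exp).const_mul m
    refine h7.deriv.trans ?_
    simp only [hθ, id, mul_one]
    ring
  have hgrad := fderiv_localizer_le hA0 hκ0.le x₁ b
  have hlimle : u t' x' - v t' x' ≤ θ t' := hmle t' ⟨ht'0, ht'.2⟩ x'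
  set D := u t₁ x₁ - v t₂ x₂ with hD
  -- The lower bound is the maximal value; the upper one passes through `u - v ≤ θ` at the limit
  -- point, by semicontinuity and continuity of `θ`.
  have hDabs : |D - θ t₁| ≤ 2 * η := by
    rw [abs_le]
    constructor <;> linarith
  have hrD : r * (D - θ t₁) ≤ |r| * (2 * η) :=
    (le_abs_self _).trans ((abs_mul r _).trans_le
      (mul_le_mul_of_nonneg_left hDabs (abs_nonneg r)))
  have hkr : θ t₁ ≤ (k - r) * θ t₁ := by
    have : 1 ≤ k - r := by linarith [le_abs_self r]
    exact le_mul_of_one_le_left (hm.le.trans hθ₁) this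
  have hrη : |r| * (2 * η) ≤ m / 4 := by
    rw [hk] at hηk
    linarith
  rw [hdθ] at hineq
  -- The left side of the inequality, without its gradient term, is `(k - r)θ - r(D - θ) ≥ m - m/4`,
  -- while all errors together stay below `η ≤ m/8`.
  linarith
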